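/- Let $M,N\ge 0$ be integers, let $V=\mathbb C^{M|N}$ have the homogeneous basis $e_1,\dots,e_{M+N}$ with $|e_i|=|i|=0$ for $i\le M$ and $|i|=1$ for $i>M$, and let $E_{ij}e_k=\delta_{jk}e_i$. Tensor products of superalgebras carry the sign rule $(a\otimes b)(a'\otimes b')=(-1)^{|b||a'|}aa'\otimes bb'$, and $X_a$ denotes $X=\sum_{i,j}E_{ij}\otimes X_{ij}$ with $E_{ij}$ in the $a$-th tensor factor. Let $P=\sum_{i,j}(-1)^{|j|}E_{ij}\otimes E_{ji}$ and $R(u)=1-u^{-1}P$. The super Yangian $\mathrm Y=\mathrm Y(\mathfrak{gl}_{M|N})$ is the complex superalgebra with generators $t_{ij}^{(r)}$ ($1\le i,j\le M+N$, $r\ge1$) of parity $|i|+|j|$ and relations $$R_{12}(u-v)T_1(u)T_2(v)=T_2(v)T_1(u)R_{12}(u-v),\qquad T(u)=\sum_{i,j}E_{ij}\otimes t_{ij}(u),\quad t_{ij}(u)=\delta_{ij}+\sum_{r\ge1}t_{ij}^{(r)}u^{-r}.$$ Write $T(u)^{-1}=\sum_{i,j} E_{ij}\otimes\tilde t_{ij}(u)$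 and $T^*(u)=\sum_{i,j} E_{ij}\otimes t^*_{ij}(u)$ with $t^*_{ij}(u)=(-1)^{|i||j|+|j|}\,\tilde t_{ji}(u)$. The quantum Berezinian is $$\mathfrak B_{M|N}(u)=\sum_{\sigma\in\mathfrak S_M}\operatorname{sgn}\sigma\; t_{\sigma(1),1}(u+M-N-1)\cdots t_{\sigma(M),M}(u-N)\;\times\;\sum_{\sigma\in\mathfrak S_N}\operatorname{sgn}\sigma\;\tilde t_{M+1,M+\sigma(1)}(u-N)\cdots\tilde t_{M+N,M+\sigma(N)}(u-1),$$ where all series are expanded in $u^{-1}$. Let $\pi_m:\mathfrak S_m\to(\operatorname{End}V)^{\otimes m}$ be the homomorphism that sends the transposition $(a\,b)$ to $P_{ab}$ for $a<b$; let $G^{(M)}=\sum_{\sigma\in\mathfrak S_M}\operatorname{sgn}(\sigma)\,\pi_M(\sigma)$, $H^{(N)}=\sum_{\sigma\in\mathfrak S_N}\pi_N(\sigma)$ and $A^{(M|N)}=G^{(M)}\otimes H^{(N)}$. Let $\mathcal I$ and $\mathcal J$ be the projections of $V$ onto its even and odd parts and let $\Im=\mathcal I_1\cdots\mathcal I_M\mathcal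 J_{M+1}\cdots\mathcal J_{M+N}$. Put $w_i=u+M-N-i$ for $i\le M$, $w_i=u-M-N-1+i$ for $i>M$, and $$\mathbb T(u)=T_1(w_1)\cdots T_M(w_M)\,T^*_{M+1}(w_{M+1})\cdots T^*_{M+N}(w_{M+N})\in\operatorname{End}V^{\otimes(M+N)}\otimes\mathrm Y[[u^{-1}]].$$ Theorem. 1. The operator $\mathcal E=\frac1{M!\,N!}\,\Im A^{(M|N)}$ on $V^{\otimes(M+N)}$ is idempotent, and the image of $A^{(M|N)}\Im$ is one-dimensional. 2. There is exactly one series $\mathfrak D(u)\in\mathrm Y[[u^{-1}]]$ with $$\Im A^{(M|N)}\,\mathfrak D(u)\,\Im=\Im A^{(M|N)}\,\mathbb T(u)\,\Im\quad\text{in }\operatorname{End}V^{\otimes(M+N)}\otimes\mathrm Y[[u^{-1}]],$$ namely $\mathfrak D(u)=\mathfrak B_{M|N}(u)$, and it lies in $1+u^{-1}\mathrm Y[[u^{-1}]]$. 3. With $\operatorname{Str}_{1,\dots,M+N}$ the full supertrace over $\operatorname{End}V^{\otimes(M+N)}$, $$\mathfrak B_{M|N}(u)=(-1)^N\operatorname{Str}_{1,\dots,M+N}\,\mathcal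 E\,\mathbb T(u)=(-1)^N\operatorname{Str}_{1,\dots,M+N}\,\mathcal E\,\mathbb T(u)\,\Im .$$ (For even $N$ the sign is $1$.) -/

import Mathlib

open scoped PowerSeries

set_option linter.unusedSectionVars false

namespace SuperYangian

/-! ## Signs and superalgebras -/

/-- The sign `(-1)^p` of a parity `p`. -/
def ksign (p : ZMod 2) : ℤ := if p = 0 then 1 else -1

theorem ksign_zero : ksign 0 = 1 := by decide

theorem ksign_add : ∀ p q : ZMod 2, ksign (p + q) = ksign p * ksign q := by decide

theorem ksign_mul_self : ∀ p : ZMod 2, ksign p * ksign p = 1 := by decide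

/-- A complex associative superalgebra. The grading is recorded by its parity automorphism
`a ↦ (-1)^|a| a`: the even (odd) part is the eigenspace for the eigenvalue `1` (`-1`). -/
class Superalgebra (A : Type*) [Ring A] [Algebra ℂ A] where
  parity : A →ₐ[ℂ] A
  parity_parity : ∀ a, parity (parity a) = a

section Parity

variable {A : Type*} [Ring A] [Algebra ℂ A] [Superalgebra A]

/-- `parityPow p a = (-1)^(p * |a|) a` for homogeneous `a`. -/
def parityPow (p : ZMod 2) : A →ₐ[ℂ] A :=
  if p = 0 then AlgHom.id ℂ A else Superalgebra.parity

theorem parityPow_zero (a : A) : parityPow 0 a = a := by simp [parityPow]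

theorem parityPow_add (p q : ZMod 2) (a : A) :
    parityPow (p + q) a = parityPow p (parityPow q a) := by
  have h : ∀ p : ZMod 2, p = 0 ∨ p = 1 := by decide
  rcases h p with rfl | rfl <;> rcases h q with rfl | rfl
  · simp [parityPow]
  · simp [parityPow]
  · simp [parityPow]
  · have : (1 + 1 : ZMod 2) = 0 := by decide
    simp [parityPow, this, Superalgebra.parity_parity]

/-- The coefficientwise superalgebra structure on formal power series
(the variable is even). -/
noncomputable instance : Superalgebra A⟦X⟧ where
  parity := PowerSeries.mapAlgHom Superalgebra.parity
  parity_parity a := by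
    ext n
    simp [PowerSeries.mapAlgHom_apply, Superalgebra.parity_parity]

end Parity

/-! ## The superalgebra `End W ⊗ A` -/

/-- `End W ⊗ A` for a superspace `W` with a homogeneous basis indexed by `ι`, of parities `p`.
The matrix `(X i j)` stands for `∑ E i j ⊗ X i j`, where `E i j` is the operator
`e k ↦ δ j k • e i`. -/
def SuperMat {ι : Type*} (_ : ι → ZMod 2) (A : Type*) : Type _ := Matrix ι ι A

namespace SuperMat

variable {ι : Type*} [Fintype ι] [DecidableEq ι] {p : ι → ZMod 2}
variable {A : Type*} [Ring A]

/-- The element `∑ E i j ⊗ X i j` given by a matrix. -/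
def of (X : Matrix ι ι A) : SuperMat p A := X

instance : AddCommGroup (SuperMat p A) := inferInstanceAs (AddCommGroup (Matrix ι ι A))

/-- The element `1 ⊗ a`. -/
def ofCoeff (a : A) : SuperMat p A := fun i j => if i = j then a else 0

instance : One (SuperMat p A) := ⟨ofCoeff 1⟩

variable [Algebra ℂ A]

/-- The element `x ⊗ 1`. -/
def ofOp (x : Matrix ι ι ℂ) : SuperMat p A := fun i j => algebraMap ℂ A (x i j)

variable [Superalgebra A]

/-- The product of the tensor product of superalgebras:
`(E i j ⊗ a) (E j k ⊗ b) = (-1)^(|a| |E j k|) E i k ⊗ a b`, with `|E j k| = |j| + |k|`. -/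
instance : Mul (SuperMat p A) :=
  ⟨fun X Y i k => ∑ j, parityPow (p j + p k) (X i j) * Y j k⟩

theorem mul_apply (X Y : SuperMat p A) (i k : ι) :
    (X * Y) i k = ∑ j, parityPow (p j + p k) (X i j) * Y j k := rfl

theorem add_apply (X Y : SuperMat p A) (i k : ι) : (X + Y) i k = X i k + Y i k := rfl

theorem sub_apply (X Y : SuperMat p A) (i k : ι) : (X - Y) i k = X i k - Y i k := rfl

theorem zero_apply (i k : ι) : (0 : SuperMat p A) i k = 0 := rfl

theorem one_apply (i k : ι) : (1 : SuperMat p A) i k = if i = k then 1 else 0 := rfl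

theorem zmod_add_self (a : ZMod 2) : a + a = 0 := by revert a; decide

instance : Ring (SuperMat p A) :=
  { (inferInstance : AddCommGroup (SuperMat p A)), (inferInstance : One (SuperMat p A)),
    (inferInstance : Mul (SuperMat p A)) with
    mul_assoc := by
      intro X Y Z
      funext i l
      simp only [mul_apply, map_sum, map_mul, Finset.sum_mul, Finset.mul_sum]
      rw [Finset.sum_comm]
      refine Finset.sum_congr rfl fun j _ => Finset.sum_congr rfl fun k _ => ?_
      rw [← parityPow_add, mul_assoc]
      have : p k + p l + (p j + p k) = p j + p l := by
        linear_combination zmod_add_self (p k)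
      rw [this]
    one_mul := by
      intro X
      funext i k
      simp only [mul_apply, one_apply]
      rw [Finset.sum_eq_single i] <;> simp +contextual [eq_comm]
    mul_one := by
      intro X
      funext i k
      simp only [mul_apply, one_apply]
      rw [Finset.sum_eq_single k] <;> simp +contextual [zmod_add_self, parityPow_zero]
    left_distrib := by
      intro X Y Z
      funext i k
      simp only [mul_apply, add_apply, mul_add, Finset.sum_add_distrib]
    right_distrib := by
      intro X Y Z
      funext i k
      simp only [mul_apply, add_apply, map_add, add_mul, Finset.sum_add_distrib]
    zero_mul := by
      intro X
      funext i k
      simp [mul_apply, zero_apply]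
    mul_zero := by
      intro X
      funext i k
      simp [mul_apply, zero_apply] }

/-- The supertrace `End W ⊗ A → A`, `E i j ⊗ a ↦ (-1)^|i| δ i j a`. -/
def str (X : SuperMat p A) : A := ∑ i, ksign (p i) • X i i

/-- The graded transposition `(X^t) i j = (-1)^(|i| |j| + |j|) X j i`. -/
def transpose (X : SuperMat p A) : SuperMat p A :=
  fun i j => ksign (p i * p j + p j) • X j i

/-- The even elements: `|X i j| = |i| + |j|` for all `i`, `j`. -/
def IsEven (X : SuperMat p A) : Prop :=
  ∀ i j, Superalgebra.parity (X i j) = ksign (p i + p j) • X i j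

theorem IsEven.mul {X Y : SuperMat p A} (hX : X.IsEven) (hY : Y.IsEven) : (X * Y).IsEven := by
  intro i k
  simp only [mul_apply, map_sum, map_mul, Finset.smul_sum]
  refine Finset.sum_congr rfl fun j _ => ?_
  have h : Superalgebra.parity (parityPow (p j + p k) (X i j)) =
      ksign (p i + p j) • parityPow (p j + p k) (X i j) := by
    unfold parityPow
    split_ifs
    · simpa using hX i j
    · rw [hX i j, map_zsmul, hX i j]
  have e : p i + p k = (p i + p j) + (p j + p k) := by
    linear_combination -zmod_add_self (p j)
  rw [h, hY j k, smul_mul_smul_comm, ← ksign_add, e]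

theorem IsEven.sub {X Y : SuperMat p A} (hX : X.IsEven) (hY : Y.IsEven) : (X - Y).IsEven := by
  intro i k
  simp only [sub_apply, map_sub, hX i k, hY i k, smul_sub]

theorem isEven_ofOp {x : Matrix ι ι ℂ} (hx : ∀ i j, x i j ≠ 0 → p i = p j) :
    (ofOp x : SuperMat p A).IsEven := by
  intro i j
  simp only [ofOp, AlgHom.commutes]
  by_cases h : x i j = 0
  · simp [h]
  · rw [hx i j h, zmod_add_self, ksign_zero, one_smul]

/-- A power series with coefficients in `End W ⊗ A`, as an element of `End W ⊗ A⟦X⟧`. -/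
noncomputable def seriesFun (f : (SuperMat p A)⟦X⟧) : SuperMat p A⟦X⟧ :=
  fun i j => PowerSeries.mk fun n => PowerSeries.coeff n f i j

theorem coeff_seriesFun (f : (SuperMat p A)⟦X⟧) (i j : ι) (n : ℕ) :
    PowerSeries.coeff n (seriesFun f i j) = PowerSeries.coeff n f i j :=
  PowerSeries.coeff_mk _ _

theorem sum_apply' {κ : Type*} (s : Finset κ) (F : κ → SuperMat p A) (i j : ι) :
    (∑ x ∈ s, F x) i j = ∑ x ∈ s, F x i j :=
  Matrix.sum_apply i j s F

theorem coeff_parityPow (q : ZMod 2) (f : A⟦X⟧) (n : ℕ) :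
    PowerSeries.coeff n (parityPow q f) = parityPow q (PowerSeries.coeff n f) := by
  unfold parityPow
  split_ifs
  · rfl
  · change PowerSeries.coeff n (PowerSeries.mapAlgHom _ _) = _
    rw [PowerSeries.mapAlgHom_apply, PowerSeries.coeff_map]
    rfl

/-- `seriesFun` is a homomorphism of rings. -/
noncomputable def ofSeries : (SuperMat p A)⟦X⟧ →+* SuperMat p A⟦X⟧ where
  toFun := seriesFun
  map_one' := by
    funext i j
    ext n
    rw [coeff_seriesFun, one_apply, PowerSeries.coeff_one]
    by_cases h : i = j <;> by_cases hn : n = 0 <;>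
      simp [h, hn, one_apply, zero_apply, PowerSeries.coeff_one]
  map_mul' f g := by
    funext i j
    ext n
    rw [coeff_seriesFun, mul_apply, map_sum, PowerSeries.coeff_mul, sum_apply']
    simp only [mul_apply]
    rw [Finset.sum_comm]
    refine Finset.sum_congr rfl fun k _ => ?_
    rw [PowerSeries.coeff_mul]
    refine Finset.sum_congr rfl fun x _ => ?_
    rw [coeff_parityPow, coeff_seriesFun, coeff_seriesFun]
  map_zero' := by
    funext i j
    ext n
    rw [coeff_seriesFun]
    simp [zero_apply]
  map_add' f g := by
    funext i j
    ext n
    rw [coeff_seriesFun, map_add, add_apply, add_apply, map_add, coeff_seriesFun,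
      coeff_seriesFun]

end SuperMat

/-! ## Operators on tensor powers -/

section Tensor

variable {ι : Type*} [Fintype ι] [DecidableEq ι]

/-- The parity of the basis vector `e (K 0) ⊗ ⋯ ⊗ e (K (m-1))` of `V^{⊗ m}`. -/
def tpar (p : ι → ZMod 2) (m : ℕ) (K : Fin m → ι) : ZMod 2 := ∑ a, p (K a)

/-- The operator `1 ⊗ ⋯ ⊗ X ⊗ ⋯ ⊗ 1` on `V^{⊗ m}`, with `X` in the place `a`: by the sign rule
`E i j` in the place `a` sends `e K` to
`(-1)^((|i| + |j|) ∑_{b < a} |K b|) δ j (K a) e K'`, where `K'` is `K` with `i` in the place `a`.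
With entries in `A` it is the element `X_a` of `End V^{⊗ m} ⊗ A`. -/
def place (p : ι → ZMod 2) {R : Type*} [AddCommGroup R] {m : ℕ} (a : Fin m) (X : Matrix ι ι R) :
    Matrix (Fin m → ι) (Fin m → ι) R :=
  Matrix.of fun L K => if ∀ b, b ≠ a → L b = K b then
    ksign ((p (L a) + p (K a)) * ∑ b ∈ Finset.univ.filter (· < a), p (K b)) • X (L a) (K a)
  else 0

/-- The operator `X ⊗ Y` on `V^{⊗ (m + n)}`, with the sign rule
`(X ⊗ Y) (v ⊗ w) = (-1)^(|Y| |v|) X v ⊗ Y w`. -/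
def tensorOp (p : ι → ZMod 2) {m n : ℕ} (X : Matrix (Fin m → ι) (Fin m → ι) ℂ)
    (Y : Matrix (Fin n → ι) (Fin n → ι) ℂ) :
    Matrix (Fin (m + n) → ι) (Fin (m + n) → ι) ℂ :=
  Matrix.of fun L K =>
    ksign ((tpar p n (fun b => L (Fin.natAdd m b)) + tpar p n (fun b => K (Fin.natAdd m b))) *
        tpar p m (fun a => K (Fin.castAdd n a))) •
      (X (fun a => L (Fin.castAdd n a)) (fun a => K (Fin.castAdd n a)) *
        Y (fun b => L (Fin.natAdd m b)) (fun b => K (Fin.natAdd m b)))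

/-- The super-permutation operator `P_{ab} = ∑ (-1)^|j| (E i j)_a (E j i)_b`, for `a < b`. -/
def superP (p : ι → ZMod 2) {m : ℕ} (a b : Fin m) : Matrix (Fin m → ι) (Fin m → ι) ℂ :=
  ∑ i, ∑ j, ksign (p j) •
    (place p a (Matrix.single i j (1 : ℂ)) * place p b (Matrix.single j i (1 : ℂ)))

/-- The exponent of the sign that arises when `σ` permutes the factors of `e K`: one crossing
`|K a| |K b|` for each inversion `a < b`, `σ b < σ a`. -/
def crossing (p : ι → ZMod 2) {m : ℕ} (σ : Equiv.Perm (Fin m)) (K : Fin m → ι) : ZMod 2 :=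
  ∑ a, ∑ b, if a < b ∧ σ b < σ a then p (K a) * p (K b) else 0

theorem sum_pairs {m : ℕ} (f : Fin m → Fin m → ZMod 2) (hf : ∀ a, f a a = 0) :
    ∑ a, ∑ b, f a b = ∑ a, ∑ b, if a < b then f a b + f b a else 0 := by
  have h1 : ∀ a b, f a b = (if a < b then f a b else 0) + (if b < a then f a b else 0) := by
    intro a b
    rcases lt_trichotomy a b with h | h | h
    · simp [h, h.not_gt]
    · subst h; simp [hf]
    · simp [h, h.not_gt]
  have h2 : ∑ a, ∑ b, (if b < a then f a b else 0) = ∑ a, ∑ b, if a < b then f b a else 0 :=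
    Finset.sum_comm
  calc ∑ a, ∑ b, f a b
      = ∑ a, ∑ b, ((if a < b then f a b else 0) + (if b < a then f a b else 0)) :=
        Finset.sum_congr rfl fun a _ => Finset.sum_congr rfl fun b _ => h1 a b
    _ = _ := by
        simp only [Finset.sum_add_distrib]
        rw [h2]
        simp only [← Finset.sum_add_distrib]
        refine Finset.sum_congr rfl fun a _ => Finset.sum_congr rfl fun b _ => ?_
        split_ifs <;> simp

theorem crossing_one (p : ι → ZMod 2) {m : ℕ} (K : Fin m → ι) :
    crossing p (1 : Equiv.Perm (Fin m)) K = 0 := by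
  unfold crossing
  refine Finset.sum_eq_zero fun a _ => Finset.sum_eq_zero fun b _ => ?_
  rw [if_neg]
  rintro ⟨h1, h2⟩
  exact absurd h1 (not_lt.mpr h2.le)

theorem crossing_mul (p : ι → ZMod 2) {m : ℕ} (σ τ : Equiv.Perm (Fin m)) (K : Fin m → ι) :
    crossing p (σ * τ) K = crossing p σ (K ∘ ⇑τ⁻¹) + crossing p τ K := by
  have h : crossing p σ (K ∘ ⇑τ⁻¹) =
      ∑ a, ∑ b, if τ a < τ b ∧ σ (τ b) < σ (τ a) then p (K a) * p (K b) else 0 := by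
    unfold crossing
    rw [← Equiv.sum_comp τ]
    refine Finset.sum_congr rfl fun a _ => ?_
    rw [← Equiv.sum_comp τ]
    simp
  rw [h]
  unfold crossing
  simp only [← Finset.sum_add_distrib]
  rw [sum_pairs _ (by simp), sum_pairs (fun a b =>
    (if τ a < τ b ∧ σ (τ b) < σ (τ a) then p (K a) * p (K b) else 0) +
      if a < b ∧ τ b < τ a then p (K a) * p (K b) else 0) (by simp)]
  refine Finset.sum_congr rfl fun a _ => Finset.sum_congr rfl fun b _ => ?_
  by_cases hab : a < b
  · have e1 : τ a ≠ τ b := fun h => hab.ne (τ.injective h)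
    have e2 : σ (τ a) ≠ σ (τ b) := fun h => e1 (σ.injective h)
    rw [mul_comm (p (K b)) (p (K a))]
    generalize p (K a) * p (K b) = x
    have hx := SuperMat.zmod_add_self x
    simp only [Equiv.Perm.coe_mul, Function.comp_apply, hab, hab.not_gt]
    rcases lt_or_gt_of_ne e1 with h1 | h1 <;> rcases lt_or_gt_of_ne e2 with h2 | h2 <;>
      simp [h1, h2, h1.not_gt, h2.not_gt, hx]
  · simp [hab]

/-- The homomorphism `π_m` from the symmetric group to `(End V)^{⊗ m}`: `σ` moves the factor in
the place `a` to the place `σ a`, with the sign of the crossings of odd vectors.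
See `superPerm_swap` for the images of the transpositions. -/
def superPerm (p : ι → ZMod 2) (m : ℕ) :
    Equiv.Perm (Fin m) →* Matrix (Fin m → ι) (Fin m → ι) ℂ where
  toFun σ := Matrix.of fun L K => if L = K ∘ ⇑σ⁻¹ then (ksign (crossing p σ K) : ℂ) else 0
  map_one' := by
    ext L K
    simp [Matrix.one_apply, crossing_one, ksign_zero]
  map_mul' σ τ := by
    ext L K
    rw [Matrix.mul_apply, Finset.sum_eq_single (K ∘ ⇑τ⁻¹)]
    · have : K ∘ ⇑(σ * τ)⁻¹ = (K ∘ ⇑τ⁻¹) ∘ ⇑σ⁻¹ := by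
        rw [mul_inv_rev]; rfl
      simp only [Matrix.of_apply]
      rw [this, crossing_mul, ksign_add]
      split_ifs <;> simp
    · intro J _ hJ
      simp only [Matrix.of_apply]
      rw [if_neg hJ, mul_zero]
    · simp

theorem place_single (p : ι → ZMod 2) {m : ℕ} (a : Fin m) (i j : ι) (L K : Fin m → ι) :
    place p a (Matrix.single i j (1 : ℂ)) L K =
      if K a = j ∧ L = Function.update K a i then
        (ksign ((p i + p j) * ∑ b ∈ Finset.univ.filter (· < a), p (K b)) : ℂ) else 0 := by
  have hL : (L = Function.update K a i) ↔ L a = i ∧ ∀ b, b ≠ a → L b = K b :=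
    Function.eq_update_iff
  simp only [place, Matrix.of_apply, Matrix.single_apply, hL]
  by_cases h1 : ∀ b, b ≠ a → L b = K b
  · by_cases h2 : L a = i
    · by_cases h3 : K a = j
      · simp [h2, h3]
      · simp [h3, Ne.symm h3]
    · simp [h2, Ne.symm h2]
  · simp [h1]

theorem crossing_swap (p : ι → ZMod 2) {m : ℕ} {a b : Fin m} (hab : a < b) (K : Fin m → ι) :
    crossing p (Equiv.swap a b) K = p (K a) * p (K b) +
      (p (K a) + p (K b)) * ∑ c ∈ Finset.univ.filter (fun c => a < c ∧ c < b), p (K c) := by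
  have key : ∀ x y, (if x < y ∧ Equiv.swap a b y < Equiv.swap a b x then p (K x) * p (K y) else 0)
      = (if x = a then if y = b then p (K a) * p (K b) else 0 else 0) +
        ((if x = a then if a < y ∧ y < b then p (K a) * p (K y) else 0 else 0) +
         (if y = b then if a < x ∧ x < b then p (K b) * p (K x) else 0 else 0)) := by
    intro x y
    rw [mul_comm (p (K b)) (p (K x))]
    simp only [Equiv.swap_apply_def]
    by_cases hxa : x = a
    · subst hxa
      by_cases hyb : y = b
      · subst hyb
        simp [hab, hab.ne']
      · by_cases hyx : y = x
        · subst hyx; simp [hyb]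
        · simp [hyb, hyx]
    · by_cases hxb : x = b
      · subst hxb
        by_cases hya : y = a
        · subst hya
          simp [hab.not_gt, hab.ne, hab.ne']
        · by_cases hyx : y = x
          · subst hyx; simp [hab.ne']
          · have : ¬ (x < y ∧ y < a) := fun h => absurd (h.1.trans h.2) hab.not_gt
            simp [hxa, hya, hyx, this]
      · by_cases hya : y = a
        · subst hya
          have : ¬ (x < y ∧ b < x) := fun h => absurd (h.2.trans h.1) hab.not_gt
          simp [hxa, hxb, hab.ne, this]
        · by_cases hyb : y = b
          · subst hyb
            simp [hxa, hxb, hab.ne', and_comm]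
          · have : ¬ (x < y ∧ y < x) := fun h => absurd h.1 h.2.not_gt
            simp [hxa, hxb, hya, hyb, this]
  unfold crossing
  simp only [key, Finset.sum_add_distrib]
  have e1 : ∑ x, ∑ y, (if x = a then if y = b then p (K a) * p (K b) else 0 else 0)
      = p (K a) * p (K b) := by
    rw [Finset.sum_eq_single a] <;> simp +contextual
  have e2 : ∑ x, ∑ y, (if x = a then if a < y ∧ y < b then p (K a) * p (K y) else 0 else 0)
      = p (K a) * ∑ c ∈ Finset.univ.filter (fun c => a < c ∧ c < b), p (K c) := by
    rw [Finset.sum_eq_single a]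
    · simp only [if_true, Finset.mul_sum, Finset.sum_filter, mul_ite, mul_zero]
    · intro x _ hx; simp [hx]
    · simp
  have e3 : ∑ x, ∑ y, (if y = b then if a < x ∧ x < b then p (K b) * p (K x) else 0 else 0)
      = p (K b) * ∑ c ∈ Finset.univ.filter (fun c => a < c ∧ c < b), p (K c) := by
    simp only [Finset.sum_ite_eq', Finset.mem_univ, if_true, Finset.mul_sum, Finset.sum_filter,
      mul_ite, mul_zero]
  rw [e1, e2, e3]
  ring

theorem sum_lt_split {m : ℕ} {a b : Fin m} (hab : a < b) (f : Fin m → ZMod 2) :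
    ∑ c ∈ Finset.univ.filter (· < b), f c = ∑ c ∈ Finset.univ.filter (· < a), f c +
      (f a + ∑ c ∈ Finset.univ.filter (fun c => a < c ∧ c < b), f c) := by
  have h : ∀ c, (if c < b then f c else 0) = (if c < a then f c else 0) +
      ((if c = a then f a else 0) + if a < c ∧ c < b then f c else 0) := by
    intro c
    rcases lt_trichotomy c a with h | h | h
    · simp [h, h.trans hab, h.ne, h.not_gt]
    · subst h; simp [hab]
    · simp [h, h.ne', h.not_gt]
  simp only [Finset.sum_filter, h, Finset.sum_add_distrib, Finset.sum_ite_eq', Finset.mem_univ,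
    if_true]

/-- `π_m` sends the transposition `(a b)` to `P_{ab}`. -/
theorem superPerm_swap (p : ι → ZMod 2) {m : ℕ} {a b : Fin m} (hab : a < b) :
    superPerm p m (Equiv.swap a b) = superP p a b := by
  ext L K
  have hK : Function.update (Function.update K b (K a)) a (K b) = K ∘ ⇑(Equiv.swap a b)⁻¹ := by
    funext c
    rw [Equiv.swap_inv, Function.comp_apply, Equiv.swap_apply_def]
    by_cases h1 : c = a
    · subst h1; simp
    · by_cases h2 : c = b
      · subst h2; simp [h1]
      · simp [h1, h2]
  have hprod : ∀ i j, (place p a (Matrix.single i j (1 : ℂ)) *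
      place p b (Matrix.single j i (1 : ℂ))) L K =
      if i = K b then if j = K a then if L = K ∘ ⇑(Equiv.swap a b)⁻¹ then
        (ksign ((p (K b) + p (K a)) * ∑ c ∈ Finset.univ.filter (· < a), p (K c)) : ℂ) *
        (ksign ((p (K a) + p (K b)) * ∑ c ∈ Finset.univ.filter (· < b), p (K c)) : ℂ)
        else 0 else 0 else 0 := by
    intro i j
    rw [Matrix.mul_apply, Finset.sum_eq_single (Function.update K b j)]
    · simp only [place_single]
      by_cases hi : i = K b
      · subst hi
        by_cases hj : j = K a
        · subst hj
          have hs : ∑ c ∈ Finset.univ.filter (· < a), p (Function.update K b (K a) c) =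
              ∑ c ∈ Finset.univ.filter (· < a), p (K c) := by
            refine Finset.sum_congr rfl fun c hc => ?_
            have : c ≠ b := ((Finset.mem_filter.mp hc).2.trans hab).ne
            simp [this]
          rw [hs, hK]
          simp [hab.ne]
          congr
        · simp [hab.ne, hj, Ne.symm hj]
      · simp [hi, Ne.symm hi]
    · intro J _ hJ
      simp [place_single, hJ]
    · simp
  simp only [superP, Matrix.sum_apply, Matrix.smul_apply, hprod]
  rw [Finset.sum_eq_single (K b), Finset.sum_eq_single (K a)]
  · simp only [superPerm, MonoidHom.coe_mk, OneHom.coe_mk, Matrix.of_apply, if_true]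
    split_ifs with hL
    · rw [crossing_swap p hab, sum_lt_split hab, zsmul_eq_mul, ← Int.cast_mul, ← Int.cast_mul,
        ← ksign_add, ← ksign_add]
      congr 2
      have h1 : p (K a) * p (K a) = p (K a) := by generalize p (K a) = x; revert x; decide
      clear hprod hK
      generalize ∑ c ∈ Finset.univ.filter (· < a), p (K c) = S at *
      generalize ∑ c ∈ Finset.univ.filter (fun c => a < c ∧ c < b), p (K c) = R at *
      revert h1
      generalize p (K a) = x
      generalize p (K b) = y
      revert x y S R
      decide
    · simp
  · intro j _ hj; simp [hj]
  · simp
  · intro i _ hi; simp [hi]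
  · simp

/-- The image `G^{(m)}` of the anti-symmetrizer `∑ sgn σ • σ` under `π_m`. -/
noncomputable def antisymmetrizer (p : ι → ZMod 2) (m : ℕ) :
    Matrix (Fin m → ι) (Fin m → ι) ℂ :=
  ∑ σ : Equiv.Perm (Fin m), (Equiv.Perm.sign σ : ℤ) • superPerm p m σ

/-- The image `H^{(m)}` of the symmetrizer `∑ σ` under `π_m`. -/
noncomputable def symmetrizer (p : ι → ZMod 2) (m : ℕ) :
    Matrix (Fin m → ι) (Fin m → ι) ℂ :=
  ∑ σ : Equiv.Perm (Fin m), superPerm p m σ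

theorem superP_even (p : ι → ZMod 2) (L K : Fin 2 → ι)
    (h : superP p (0 : Fin 2) 1 L K ≠ 0) : tpar p 2 L = tpar p 2 K := by
  rw [← superPerm_swap p (by decide)] at h
  simp only [superPerm, MonoidHom.coe_mk, OneHom.coe_mk, Matrix.of_apply] at h
  have hL : L = K ∘ ⇑(Equiv.swap (0 : Fin 2) 1)⁻¹ := by
    by_contra hne
    exact h (if_neg hne)
  subst hL
  simp [tpar, Fin.sum_univ_two, add_comm]

theorem place_even {A : Type*} [Ring A] [Algebra ℂ A] [Superalgebra A] (p : ι → ZMod 2) {m : ℕ}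
    (a : Fin m) (X : SuperMat p A) (hX : X.IsEven) :
    (SuperMat.of (place p a X) : SuperMat (tpar p m) A).IsEven := by
  intro L K
  simp only [SuperMat.of, place, Matrix.of_apply]
  split_ifs with h
  · have e : tpar p m L + tpar p m K = p (L a) + p (K a) := by
      have h2 : ∑ b ∈ Finset.univ.erase a, p (L b) = ∑ b ∈ Finset.univ.erase a, p (K b) :=
        Finset.sum_congr rfl fun b hb => by rw [h b (Finset.ne_of_mem_erase hb)]
      unfold tpar
      rw [← Finset.add_sum_erase _ _ (Finset.mem_univ a),
        ← Finset.add_sum_erase (a := a) _ (fun b => p (K b)) (Finset.mem_univ a), h2]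
      linear_combination SuperMat.zmod_add_self (∑ b ∈ Finset.univ.erase a, p (K b))
    rw [map_zsmul, hX, e, smul_comm]
  · simp

end Tensor

/-! ## The super Yangian -/

section Yangian

variable (M N : ℕ)

/-- The parity of the basis vector `e i` of `ℂ^{M|N}` (places are counted from `0`). -/
def par (i : Fin (M + N)) : ZMod 2 := if i.val < M then 0 else 1

/-- Labels of the generators: `⟨i, j, r⟩` stands for `t_{ij}^{(r+1)}`. -/
structure YGen where
  row : Fin (M + N)
  col : Fin (M + N)
  deg : ℕ

noncomputable instance : Superalgebra (FreeAlgebra ℂ (YGen M N)) where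
  parity := FreeAlgebra.lift ℂ fun g =>
    ksign (par M N g.row + par M N g.col) • FreeAlgebra.ι ℂ g
  parity_parity a := by
    have h : ((FreeAlgebra.lift ℂ fun g : YGen M N =>
        ksign (par M N g.row + par M N g.col) • FreeAlgebra.ι ℂ g).comp
        (FreeAlgebra.lift ℂ fun g : YGen M N =>
        ksign (par M N g.row + par M N g.col) • FreeAlgebra.ι ℂ g)) = AlgHom.id ℂ _ := by
      ext g
      simp only [AlgHom.comp_apply, Function.comp_apply, FreeAlgebra.lift_ι_apply, map_zsmul,
        smul_smul, ksign_mul_self, one_smul, AlgHom.id_apply]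
    exact DFunLike.congr_fun h a

/-- The matrices `(t_{ij}^{(r)})` over the free algebra, with `t_{ij}^{(0)} = δ i j`. -/
def freeT (r : ℕ) : SuperMat (par M N) (FreeAlgebra ℂ (YGen M N)) :=
  match r with
  | 0 => 1
  | r + 1 => fun i j => FreeAlgebra.ι ℂ ⟨i, j, r⟩

/-- `T_1^{(r)}` or `T_2^{(r)}` in `End V^{⊗ 2} ⊗ A`. -/
def freeTAt (a : Fin 2) (r : ℕ) :
    SuperMat (tpar (par M N) 2) (FreeAlgebra ℂ (YGen M N)) :=
  SuperMat.of (place (par M N) a (freeT M N r))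

/-- The operator `P ⊗ 1` in `End V^{⊗ 2} ⊗ A`. -/
noncomputable def freeP : SuperMat (tpar (par M N) 2) (FreeAlgebra ℂ (YGen M N)) :=
  SuperMat.ofOp (superP (par M N) 0 1)

/-- The coefficient of `u^{-r} v^{-s}` in `(u - v) R(u - v) T_1(u) T_2(v)`, where
`(u - v) R(u - v) = u - v - P`. -/
noncomputable def rttLeft (r s : ℕ) : SuperMat (tpar (par M N) 2) (FreeAlgebra ℂ (YGen M N)) :=
  freeTAt M N 0 (r + 1) * freeTAt M N 1 s - freeTAt M N 0 r * freeTAt M N 1 (s + 1) -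
    freeP M N * (freeTAt M N 0 r * freeTAt M N 1 s)

/-- The coefficient of `u^{-r} v^{-s}` in `(u - v) T_2(v) T_1(u) R(u - v)`. -/
noncomputable def rttRight (r s : ℕ) : SuperMat (tpar (par M N) 2) (FreeAlgebra ℂ (YGen M N)) :=
  freeTAt M N 1 s * freeTAt M N 0 (r + 1) - freeTAt M N 1 (s + 1) * freeTAt M N 0 r -
    freeTAt M N 1 s * freeTAt M N 0 r * freeP M N

/-- The defining relations `R(u - v) T_1(u) T_2(v) = T_2(v) T_1(u) R(u - v)`, entry by entry and
coefficient by coefficient. (The coefficients of `u v^{-s}` and of `u^{-r} v` in the relation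
multiplied by `u - v` agree trivially, because `T^{(0)} = 1`.) -/
inductive YRel : FreeAlgebra ℂ (YGen M N) → FreeAlgebra ℂ (YGen M N) → Prop
  | rtt (r s : ℕ) (L K : Fin 2 → Fin (M + N)) : YRel (rttLeft M N r s L K) (rttRight M N r s L K)

/-- The super Yangian `Y(gl_{M|N})`. -/
abbrev Yangian : Type := RingQuot (YRel M N)

theorem freeT_even (r : ℕ) : (freeT M N r).IsEven := by
  intro i j
  cases r with
  | zero =>
    simp only [freeT, SuperMat.one_apply]
    split_ifs with h
    · subst h; simp [SuperMat.zmod_add_self, ksign_zero]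
    · simp
  | succ r => exact FreeAlgebra.lift_ι_apply _ _

theorem freeTAt_even (a : Fin 2) (r : ℕ) : (freeTAt M N a r).IsEven :=
  place_even _ _ _ (freeT_even M N r)

theorem freeP_even : (freeP M N).IsEven :=
  SuperMat.isEven_ofOp fun L K h => superP_even _ L K h

theorem rttLeft_even (r s : ℕ) : (rttLeft M N r s).IsEven :=
  ((((freeTAt_even M N _ _).mul (freeTAt_even M N _ _)).sub
    ((freeTAt_even M N _ _).mul (freeTAt_even M N _ _))).sub
    ((freeP_even M N).mul ((freeTAt_even M N _ _).mul (freeTAt_even M N _ _))))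

theorem rttRight_even (r s : ℕ) : (rttRight M N r s).IsEven :=
  ((((freeTAt_even M N _ _).mul (freeTAt_even M N _ _)).sub
    ((freeTAt_even M N _ _).mul (freeTAt_even M N _ _))).sub
    (((freeTAt_even M N _ _).mul (freeTAt_even M N _ _)).mul (freeP_even M N)))

theorem parity_rel ⦃x y : FreeAlgebra ℂ (YGen M N)⦄ (h : YRel M N x y) :
    (RingQuot.mkAlgHom ℂ (YRel M N)).comp Superalgebra.parity x =
      (RingQuot.mkAlgHom ℂ (YRel M N)).comp Superalgebra.parity y := by
  cases h with
  | rtt r s L K =>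
    simp only [AlgHom.comp_apply]
    rw [rttLeft_even M N r s L K, rttRight_even M N r s L K, map_zsmul, map_zsmul,
      RingQuot.mkAlgHom_rel ℂ (YRel.rtt r s L K)]

/-- The grading of the super Yangian, `|t_{ij}^{(r)}| = |i| + |j|`. -/
noncomputable instance : Superalgebra (Yangian M N) where
  parity := RingQuot.liftAlgHom ℂ
    ⟨(RingQuot.mkAlgHom ℂ (YRel M N)).comp Superalgebra.parity, parity_rel M N⟩
  parity_parity a := by
    obtain ⟨x, rfl⟩ := RingQuot.mkAlgHom_surjective ℂ (YRel M N) a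
    simp [Superalgebra.parity_parity]

/-- The matrices `T^{(r)} = (t_{ij}^{(r)})` over the super Yangian, with `T^{(0)} = 1`. -/
noncomputable def coeffT (r : ℕ) : SuperMat (par M N) (Yangian M N) :=
  fun i j => RingQuot.mkAlgHom ℂ (YRel M N) (freeT M N r i j)

/-- The generator matrix `T(u)`. The variable `X` of power series stands for `u⁻¹`. -/
noncomputable def T : SuperMat (par M N) (Yangian M N)⟦X⟧ :=
  fun i j => PowerSeries.mk fun r => coeffT M N r i j

/-- `T(u)` is invertible, so that the next definition is the true inverse. -/
theorem isUnit_T : IsUnit (T M N) := by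
  have h : T M N = SuperMat.ofSeries (PowerSeries.mk (coeffT M N)) := by
    funext i j
    ext n
    exact (SuperMat.coeff_seriesFun (PowerSeries.mk (coeffT M N)) i j n ▸
      by rw [T, PowerSeries.coeff_mk, PowerSeries.coeff_mk])
  have h0 : coeffT M N 0 = 1 := by
    funext i j
    simp only [coeffT, freeT, SuperMat.one_apply]
    split_ifs <;> simp
  have hc : PowerSeries.constantCoeff (PowerSeries.mk (coeffT M N)) =
      ((1 : (SuperMat (par M N) (Yangian M N))ˣ) : SuperMat (par M N) (Yangian M N)) := by
    rw [← PowerSeries.coeff_zero_eq_constantCoeff_apply, PowerSeries.coeff_mk, h0, Units.val_one]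
  rw [h]
  refine IsUnit.map SuperMat.ofSeries ?_
  exact ⟨⟨_, _, PowerSeries.mul_invOfUnit _ 1 hc, PowerSeries.invOfUnit_mul _ 1 hc⟩, rfl⟩

/-- The inverse matrix `T(u)⁻¹ = (t̃_{ij}(u))`. -/
noncomputable def Tinv : SuperMat (par M N) (Yangian M N)⟦X⟧ := Ring.inverse (T M N)

/-- The matrix `T*(u) = (T(u)⁻¹)^t`. -/
noncomputable def Tstar : SuperMat (par M N) (Yangian M N)⟦X⟧ := (Tinv M N).transpose

/-- The series `f(u + c)`, expanded in `u⁻¹`, for a series `f(u) = ∑ f_r u^{-r}`: the sum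
`∑ (u + c)^{-r} f_r` with `(u + c)⁻¹ = u⁻¹ (1 + c u⁻¹)⁻¹`. Only `r ≤ n` contribute to the
coefficient of `u^{-n}`. -/
noncomputable def shift {A : Type*} [Ring A] [Algebra ℂ A] (c : ℂ) (f : A⟦X⟧) : A⟦X⟧ :=
  PowerSeries.mk fun n => ∑ r ∈ Finset.range (n + 1),
    PowerSeries.coeff n ((PowerSeries.X * (1 + PowerSeries.C c * PowerSeries.X)⁻¹) ^ r : ℂ⟦X⟧) •
      PowerSeries.coeff r f

/-- The quantum Berezinian
`∑_σ sgn σ t_{σ(1),1}(u+M-N-1) ⋯ t_{σ(M),M}(u-N) ×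
  ∑_τ sgn τ t̃_{M+1,M+τ(1)}(u-N) ⋯ t̃_{M+N,M+τ(N)}(u-1)`. -/
noncomputable def berezinian : (Yangian M N)⟦X⟧ :=
  (∑ σ : Equiv.Perm (Fin M), (Equiv.Perm.sign σ : ℤ) •
    (List.ofFn fun k : Fin M =>
      shift ((M : ℂ) - N - ((k : ℕ) + 1)) (T M N (Fin.castAdd N (σ k)) (Fin.castAdd N k))).prod) *
  (∑ τ : Equiv.Perm (Fin N), (Equiv.Perm.sign τ : ℤ) •
    (List.ofFn fun k : Fin N =>
      shift (-(N : ℂ) + (k : ℕ)) (Tinv M N (Fin.natAdd M k) (Fin.natAdd M (τ k)))).prod)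

/-! ## The fused operators -/

/-- The shift `w_i - u` of the spectral parameter; the place `a` is the index `i = a + 1`:
`w_i = u + M - N - i` for `i ≤ M`, and `w_i = u - M - N - 1 + i` for `i > M`. -/
noncomputable def wShift (a : Fin (M + N)) : ℂ :=
  if a.val < M then (M : ℂ) - N - ((a : ℕ) + 1) else -(M : ℂ) - N - 1 + ((a : ℕ) + 1)

/-- The projection `𝓘` of `V` onto its even part. -/
def projEven : Matrix (Fin (M + N)) (Fin (M + N)) ℂ :=
  Matrix.diagonal fun i => if par M N i = 0 then 1 else 0

/-- The projection `𝓙` of `V` onto its odd part. -/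
def projOdd : Matrix (Fin (M + N)) (Fin (M + N)) ℂ :=
  Matrix.diagonal fun i => if par M N i = 1 then 1 else 0

/-- The operator `ℑ = 𝓘_1 ⋯ 𝓘_M 𝓙_{M+1} ⋯ 𝓙_{M+N}` on `V^{⊗ (M+N)}`. -/
def projMixed : Matrix (Fin (M + N) → Fin (M + N)) (Fin (M + N) → Fin (M + N)) ℂ :=
  (List.ofFn fun a : Fin (M + N) =>
    place (par M N) a (if a.val < M then projEven M N else projOdd M N)).prod

/-- The operator `A^{(M|N)} = G^{(M)} ⊗ H^{(N)}` on `V^{⊗ (M+N)}`. -/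
noncomputable def fusionOp : Matrix (Fin (M + N) → Fin (M + N)) (Fin (M + N) → Fin (M + N)) ℂ :=
  tensorOp (par M N) (antisymmetrizer (par M N) M) (symmetrizer (par M N) N)

/-- The normalized operator `(M! N!)⁻¹ ℑ A^{(M|N)}`. -/
noncomputable def fusionProj : Matrix (Fin (M + N) → Fin (M + N)) (Fin (M + N) → Fin (M + N)) ℂ :=
  ((M.factorial : ℂ) * (N.factorial : ℂ))⁻¹ • (projMixed M N * fusionOp M N)

/-- The superalgebra `End V^{⊗ (M+N)} ⊗ Y(gl_{M|N})⟦u⁻¹⟧`. -/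
abbrev FusionAlg : Type := SuperMat (tpar (par M N) (M + N)) (Yangian M N)⟦X⟧

/-- The product `T_1(w_1) ⋯ T_M(w_M) T*_{M+1}(w_{M+1}) ⋯ T*_{M+N}(w_{M+N})`. -/
noncomputable def fusedT : FusionAlg M N :=
  (List.ofFn fun a : Fin (M + N) =>
    (SuperMat.of (place (par M N) a fun i j =>
      shift (wShift M N a) (if a.val < M then T M N i j else Tstar M N i j)) :
        FusionAlg M N)).prod

end Yangian

end SuperYangian

/-! The operator $\Im A^{(M|N)}$ has rank one. On even basis vectors $\pi_M$ permutes without signs,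
so $G^{(M)}$ is an ordinary antisymmetrizer. On odd basis vectors $\pi_N(\sigma)$ carries the sign
of $\sigma$, so $H^{(N)}$ becomes an ordinary antisymmetrizer too. Hence $\Im A^{(M|N)}=vv^{\mathsf
T}$ (`projMixed_mul_fusionOp`) with
$v=\sum_{\sigma,\tau}\operatorname{sgn}\sigma\,\operatorname{sgn}\tau\;e_{\sigma}\otimes e_{\tau}$,
where $\sigma$ fills the first $M$ places with even indices and $\tau$ the last $N$ places with odd
ones. Since $v^{\mathsf T}v=M!\,N!$, part 1 follows.

Everything else reduces to $\sum_J v_J\,\mathbb T(u)_{JK}=v_K\,\mathfrak B_{M|N}(u)$ for $K$ in the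
image of $\Im$ (`sum_fusionVec_smul_fusedT`). For such $J$ and $K$ the parities agree place by
place, so every sign of the super tensor product is trivial, and $\mathbb T(u)_{JK}$ is the plain
product of entries of $T$ and of $T^{-1}$ (`fusedT_mix`). The sum over $J$ is then a product of two
alternating sums with columns $K$, and it remains to see that each is antisymmetric in its columns.

This needs the defining relation only between neighbouring factors, whose spectral parameters differ
by $1$ for $T$ and by $-1$ for $T^{-1}$. There $(u-v)(T_1T_2-T_2T_1)=PT_1T_2-T_2T_1P$ gives a
four-term exchange identity (`evenFactor_rel`, `oddFactor_rel`), and neighbouring transpositions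
generate the symmetric group (`altSum_comp_right`). No product of R-matrices is formed.

Both sides of the fusion identity thus have the entries $v_Lv_K\mathfrak B_{M|N}(u)$, and the entry
with $v_L=v_K=1$ gives uniqueness. The diagonal entries of $\mathcal E\,\mathbb T(u)$ are
$v_K^2\,\mathfrak B_{M|N}(u)/(M!\,N!)$, and $v$ is supported on basis vectors of parity $N$, whence
the supertrace formulas and their sign. -/

namespace SuperYangian

/-! ## The substitution `u ↦ u + c` -/

section Shift

variable {A : Type*} [Ring A] [Algebra ℂ A]

/-- The series `(u + c)⁻¹`, expanded in `X = u⁻¹`. -/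
noncomputable def shiftVar (c : ℂ) : ℂ⟦X⟧ :=
  PowerSeries.X * (1 + PowerSeries.C c * PowerSeries.X)⁻¹

theorem X_dvd_shiftVar (c : ℂ) : (PowerSeries.X : ℂ⟦X⟧) ∣ shiftVar c := Dvd.intro _ rfl

theorem one_add_mul_shiftVar (c : ℂ) :
    (1 + PowerSeries.C c * PowerSeries.X) * shiftVar c = PowerSeries.X := by
  rw [shiftVar, mul_left_comm, PowerSeries.mul_inv_cancel _ (by simp), mul_one]

theorem coeff_pow_mul_pow_eq_zero {x y : ℂ⟦X⟧} (hx : PowerSeries.X ∣ x) (hy : PowerSeries.X ∣ y)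
    (w : ℂ⟦X⟧) {n r s : ℕ} (h : n < r + s) :
    PowerSeries.coeff n (w * (x ^ r * y ^ s)) = 0 := by
  refine PowerSeries.X_pow_dvd_iff.mp ?_ n h
  rw [pow_add]
  exact Dvd.dvd.mul_left (mul_dvd_mul (pow_dvd_pow_of_dvd hx r) (pow_dvd_pow_of_dvd hy s)) w

/-- Since $(u+c)^{-r}$ is divisible by $X^r$, any truncation beyond $n$ gives the same coefficient.
The free bound lets several series be cut at the same place. -/
theorem coeff_shift (c : ℂ) (f : A⟦X⟧) {n N : ℕ} (h : n < N) :
    PowerSeries.coeff n (shift c f) =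
      ∑ r ∈ Finset.range N, PowerSeries.coeff n (shiftVar c ^ r) • PowerSeries.coeff r f := by
  rw [shift, PowerSeries.coeff_mk]
  refine Finset.sum_subset (Finset.range_mono h) fun r _ hr => ?_
  have := coeff_pow_mul_pow_eq_zero (X_dvd_shiftVar c) (X_dvd_shiftVar c) 1
    (n := n) (r := r) (s := 0) (by simp at hr; omega)
  rw [one_mul, pow_zero, mul_one] at this
  change PowerSeries.coeff n (shiftVar c ^ r) • _ = 0
  rw [this, zero_smul]

/-- The series `∑ (u + c)^{-r} (u + d)^{-s} g r s`. -/
noncomputable def shiftTwo (c d : ℂ) : (ℕ → ℕ → A) →ₗ[ℂ] A⟦X⟧ where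
  toFun g := PowerSeries.mk fun n => ∑ r ∈ Finset.range (n + 1), ∑ s ∈ Finset.range (n + 1),
    PowerSeries.coeff n (shiftVar c ^ r * shiftVar d ^ s) • g r s
  map_add' f g := by ext n; simp [Finset.sum_add_distrib]
  map_smul' z g := by ext n; simp [Finset.smul_sum, smul_comm z]

theorem coeff_shiftTwo (c d : ℂ) (g : ℕ → ℕ → A) {n N : ℕ} (h : n < N) :
    PowerSeries.coeff n (shiftTwo c d g) =
      ∑ r ∈ Finset.range N, ∑ s ∈ Finset.range N,
        PowerSeries.coeff n (shiftVar c ^ r * shiftVar d ^ s) • g r s := by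
  have hz : ∀ r s, n < r + s →
      PowerSeries.coeff n (shiftVar c ^ r * shiftVar d ^ s) • g r s = 0 := by
    intro r s hrs
    have := coeff_pow_mul_pow_eq_zero (X_dvd_shiftVar c) (X_dvd_shiftVar d) 1 hrs
    rw [one_mul] at this
    rw [this, zero_smul]
  have h0 : PowerSeries.coeff n (shiftTwo c d g) =
      ∑ r ∈ Finset.range (n + 1), ∑ s ∈ Finset.range (n + 1),
        PowerSeries.coeff n (shiftVar c ^ r * shiftVar d ^ s) • g r s := by
    simp only [shiftTwo, LinearMap.coe_mk, AddHom.coe_mk, PowerSeries.coeff_mk]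
  rw [h0]
  calc _ = ∑ r ∈ Finset.range (n + 1), ∑ s ∈ Finset.range N,
        PowerSeries.coeff n (shiftVar c ^ r * shiftVar d ^ s) • g r s := by
        refine Finset.sum_congr rfl fun r _ =>
          Finset.sum_subset (Finset.range_mono h) fun s _ hs => hz r s ?_
        simp at hs; omega
    _ = _ := by
        refine Finset.sum_subset (Finset.range_mono h) fun r _ hr =>
          Finset.sum_eq_zero fun s _ => hz r s ?_
        simp at hr; omega

theorem shift_mul_shift (c d : ℂ) (f h : A⟦X⟧) :
    shift c f * shift d h =
      shiftTwo c d fun r s => PowerSeries.coeff r f * PowerSeries.coeff s h := by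
  ext n
  rw [coeff_shiftTwo c d _ n.lt_succ_self, PowerSeries.coeff_mul]
  have e : ∀ x ∈ Finset.HasAntidiagonal.antidiagonal n,
      PowerSeries.coeff x.1 (shift c f) * PowerSeries.coeff x.2 (shift d h) =
      ∑ r ∈ Finset.range n.succ, ∑ s ∈ Finset.range n.succ,
        (PowerSeries.coeff x.1 (shiftVar c ^ r) * PowerSeries.coeff x.2 (shiftVar d ^ s)) •
          (PowerSeries.coeff r f * PowerSeries.coeff s h) := by
    intro x hx
    rw [Finset.HasAntidiagonal.mem_antidiagonal] at hx
    rw [coeff_shift c f (N := n.succ) (by omega), coeff_shift d h (N := n.succ) (by omega),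
      Finset.sum_mul_sum]
    simp only [smul_mul_smul_comm]
  rw [Finset.sum_congr rfl e, Finset.sum_comm]
  refine Finset.sum_congr rfl fun r _ => ?_
  rw [Finset.sum_comm]
  refine Finset.sum_congr rfl fun s _ => ?_
  rw [PowerSeries.coeff_mul, Finset.sum_smul]

theorem shiftTwo_swap (c d : ℂ) (g : ℕ → ℕ → A) :
    shiftTwo d c (fun s r => g r s) = shiftTwo c d g := by
  ext n
  rw [coeff_shiftTwo c d _ n.lt_succ_self, coeff_shiftTwo d c _ n.lt_succ_self, Finset.sum_comm]
  simp only [mul_comm (shiftVar d ^ _)]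

/-- At equal shifts $(u+c)^{-r}(u+c)^{-s}$ depends only on $r+s$. Grouping the double sum by $r+s$
gives the product coefficients; the terms with $r+s>n$ do not reach degree $n$. -/
theorem shift_mul (c : ℂ) (f h : A⟦X⟧) : shift c (f * h) = shift c f * shift c h := by
  rw [shift_mul_shift]
  ext n
  rw [coeff_shift c _ n.lt_succ_self, coeff_shiftTwo c c _ n.lt_succ_self]
  set F : ℕ → ℕ → A := fun r s => PowerSeries.coeff n (shiftVar c ^ r * shiftVar c ^ s) •
    (PowerSeries.coeff r f * PowerSeries.coeff s h) with hF
  have h1 : ∀ k ∈ Finset.range n.succ,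
      PowerSeries.coeff n (shiftVar c ^ k) • PowerSeries.coeff k (f * h) =
        ∑ r ∈ Finset.range (k + 1), F r (k - r) := by
    intro k _
    rw [PowerSeries.coeff_mul, Finset.Nat.sum_antidiagonal_eq_sum_range_succ
      (fun i j => PowerSeries.coeff i f * PowerSeries.coeff j h), Finset.smul_sum]
    refine Finset.sum_congr rfl fun r hr => ?_
    rw [hF]
    simp only
    rw [← pow_add, Nat.add_sub_cancel' (by simp at hr; omega)]
  rw [Finset.sum_congr rfl h1, Finset.sum_range_diag_flip]
  refine Finset.sum_congr rfl fun r _ =>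
    Finset.sum_subset (Finset.range_mono (by omega)) fun s _ hs => ?_
  have := coeff_pow_mul_pow_eq_zero (X_dvd_shiftVar c) (X_dvd_shiftVar c) 1
    (n := n) (r := r) (s := s) (by simp at hs; omega)
  rw [one_mul] at this
  rw [hF]
  simp only [this, zero_smul]

theorem shift_add (c : ℂ) (f h : A⟦X⟧) : shift c (f + h) = shift c f + shift c h := by
  ext n
  simp [shift, Finset.sum_add_distrib]

theorem coeff_zero_shift (c : ℂ) (f : A⟦X⟧) :
    PowerSeries.constantCoeff (shift c f) = PowerSeries.constantCoeff f := by
  rw [← PowerSeries.coeff_zero_eq_constantCoeff_apply,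
    ← PowerSeries.coeff_zero_eq_constantCoeff_apply, coeff_shift c f Nat.zero_lt_one]
  simp

theorem shift_one (c : ℂ) : shift c (1 : A⟦X⟧) = 1 := by
  ext n
  rw [coeff_shift c _ n.lt_succ_self, Finset.sum_eq_single 0]
  · simp [PowerSeries.coeff_one]
  · intro r _ hr
    simp [PowerSeries.coeff_one, hr]
  · simp

/-- The substitution `u ↦ u + c` as a homomorphism of rings. -/
noncomputable def shiftHom (c : ℂ) : A⟦X⟧ →+* A⟦X⟧ where
  toFun := shift c
  map_one' := shift_one c
  map_mul' := shift_mul c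
  map_zero' := by ext n; simp [shift]
  map_add' := shift_add c

/-- If `g` and `k` are the coefficients of `G(u, v)` and `(u - v) G(u, v)`, then
`(c - d) G(u + c, u + d)` is the specialization of `(u - v) G(u, v)`. -/
theorem zsmul_shiftTwo (c d : ℂ) (z : ℤ) (hz : c - d = z) (g k : ℕ → ℕ → A)
    (h0 : ∀ s, g 0 s = 0) (h0' : ∀ r, g r 0 = 0)
    (hgk : ∀ r s, g (r + 1) s - g r (s + 1) = k r s) :
    z • shiftTwo c d g = shiftTwo c d k := by
  ext n
  -- With $x=(u+c)^{-1}$ and $y=(u+d)^{-1}$ the point is $y-x=(c-d)xy$. Multiplication by $w$, with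
  -- $wxy=X^2$, turns this into $(c-d)X^2=wy-wx$ and so avoids lowering the exponents of $x$ and
  -- $y$.
  set w : ℂ⟦X⟧ := (1 + PowerSeries.C c * PowerSeries.X) * (1 + PowerSeries.C d * PowerSeries.X)
    with hw
  set a : ℕ → ℕ → ℂ := fun r s =>
    PowerSeries.coeff (n + 2) (w * (shiftVar c ^ r * shiftVar d ^ s)) with ha
  have hc := one_add_mul_shiftVar c
  have hd := one_add_mul_shiftVar d
  have ha0 : ∀ r s, n + 2 < r + s → a r s = 0 := fun r s h =>
    coeff_pow_mul_pow_eq_zero (X_dvd_shiftVar c) (X_dvd_shiftVar d) w h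
  have e1 : ∀ r s, PowerSeries.coeff n (shiftVar c ^ r * shiftVar d ^ s) = a (r + 1) (s + 1) := by
    intro r s
    rw [ha]
    simp only
    rw [← PowerSeries.coeff_X_pow_mul _ 2 n]
    congr 1
    rw [hw]
    linear_combination (-(PowerSeries.X : ℂ⟦X⟧) * hc - (1 + PowerSeries.C c * PowerSeries.X) *
      shiftVar c * hd) * (shiftVar c ^ r * shiftVar d ^ s)
  have e2 : ∀ r s, (z : ℂ) * PowerSeries.coeff n (shiftVar c ^ r * shiftVar d ^ s) =
      a r (s + 1) - a (r + 1) s := by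
    intro r s
    rw [ha]
    simp only
    rw [← map_sub, ← PowerSeries.coeff_X_pow_mul _ 2 n, ← PowerSeries.coeff_C_mul, ← hz]
    congr 1
    rw [hw, map_sub]
    linear_combination (-(1 + PowerSeries.C c * PowerSeries.X) * hd +
      (1 + PowerSeries.C d * PowerSeries.X) * hc) * (shiftVar c ^ r * shiftVar d ^ s)
  have hl : PowerSeries.coeff n (z • shiftTwo c d g) =
      ∑ r ∈ Finset.range (n + 3), ∑ s ∈ Finset.range (n + 3),
        (a r (s + 1) - a (r + 1) s) • g r s := by
    rw [map_zsmul, coeff_shiftTwo c d _ (show n < n + 3 by omega), ← Int.cast_smul_eq_zsmul ℂ,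
      Finset.smul_sum]
    refine Finset.sum_congr rfl fun r _ => ?_
    rw [Finset.smul_sum]
    refine Finset.sum_congr rfl fun s _ => ?_
    rw [smul_smul, e2]
  rw [hl, coeff_shiftTwo c d _ (show n < n + 3 by omega)]
  -- Summation by parts: the lower boundary term vanishes because $g$ vanishes on the axes, the
  -- upper one because `a` vanishes for $r+s>n+2$. This is why the range is `n + 3`.
  have s1 : ∑ r ∈ Finset.range (n + 3), ∑ s ∈ Finset.range (n + 3), a r (s + 1) • g r s =
      ∑ r ∈ Finset.range (n + 3), ∑ s ∈ Finset.range (n + 3), a (r + 1) (s + 1) • g (r + 1) s := by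
    have := Finset.sum_range_succ
      (fun r => ∑ s ∈ Finset.range (n + 3), a r (s + 1) • g r s) (n + 3)
    rw [Finset.sum_range_succ', Finset.sum_eq_zero (s := Finset.range (n + 3))
      (f := fun s => a (n + 3) (s + 1) • g (n + 3) s)
      (fun s _ => by rw [ha0 _ _ (by omega), zero_smul])] at this
    simp only [h0, smul_zero, Finset.sum_const_zero, add_zero] at this
    exact this.symm
  have s2 : ∑ r ∈ Finset.range (n + 3), ∑ s ∈ Finset.range (n + 3), a (r + 1) s • g r s =
      ∑ r ∈ Finset.range (n + 3), ∑ s ∈ Finset.range (n + 3), a (r + 1) (s + 1) • g r (s + 1) := by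
    refine Finset.sum_congr rfl fun r _ => ?_
    have := Finset.sum_range_succ (fun s => a (r + 1) s • g r s) (n + 3)
    rw [Finset.sum_range_succ', ha0 _ _ (by omega : n + 2 < (r + 1) + (n + 3))] at this
    simp only [h0', smul_zero, zero_smul, add_zero] at this
    exact this.symm
  simp only [sub_smul, Finset.sum_sub_distrib]
  rw [s1, s2]
  simp only [← Finset.sum_sub_distrib, ← smul_sub, hgk, e1]

end Shift

/-! ## Operators in one place of a tensor power -/

section Place

variable {ι : Type*} [Fintype ι] [DecidableEq ι] {p : ι → ZMod 2} {m : ℕ}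
variable {A : Type*} [Ring A] [Algebra ℂ A] [Superalgebra A]

theorem SuperMat.ext {X Y : SuperMat p A} (h : ∀ i j, X i j = Y i j) : X = Y :=
  funext fun i => funext fun j => h i j

theorem tpar_add_tpar {a : Fin m} {L K : Fin m → ι} (h : ∀ b, b ≠ a → L b = K b) :
    tpar p m L + tpar p m K = p (L a) + p (K a) := by
  have h2 : ∑ b ∈ Finset.univ.erase a, p (L b) = ∑ b ∈ Finset.univ.erase a, p (K b) :=
    Finset.sum_congr rfl fun b hb => by rw [h b (Finset.ne_of_mem_erase hb)]
  unfold tpar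
  rw [← Finset.add_sum_erase _ _ (Finset.mem_univ a),
    ← Finset.add_sum_erase (a := a) _ (fun b => p (K b)) (Finset.mem_univ a), h2]
  linear_combination SuperMat.zmod_add_self (∑ b ∈ Finset.univ.erase a, p (K b))

theorem sum_eq_sum_update {R : Type*} [AddCommMonoid R] (a : Fin m) (K : Fin m → ι)
    (f : (Fin m → ι) → R) (hf : ∀ J, ¬ (∀ b, b ≠ a → J b = K b) → f J = 0) :
    ∑ J, f J = ∑ j, f (Function.update K a j) := by
  refine (Fintype.sum_of_injective (fun j => Function.update K a j)
    (Function.update_injective K a) _ _ ?_ fun _ => rfl).symm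
  intro J hJ
  refine hf J fun h => hJ ⟨J a, ?_⟩
  exact (Function.eq_update_iff.mpr ⟨rfl, h⟩).symm

/-- The element `X_a` of `End V^{⊗ m} ⊗ A`. -/
def SuperMat.placed (a : Fin m) (X : SuperMat p A) : SuperMat (tpar p m) A :=
  SuperMat.of (place p a X)

theorem SuperMat.placed_apply (a : Fin m) (X : SuperMat p A) (L K : Fin m → ι) :
    SuperMat.placed a X L K = if ∀ b, b ≠ a → L b = K b then
      ksign ((p (L a) + p (K a)) * ∑ b ∈ Finset.univ.filter (· < a), p (K b)) • X (L a) (K a)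
    else 0 := rfl

theorem SuperMat.placed_one (a : Fin m) : SuperMat.placed a (1 : SuperMat p A) = 1 := by
  refine SuperMat.ext fun L K => ?_
  rw [SuperMat.placed_apply, SuperMat.one_apply, SuperMat.one_apply]
  by_cases h : L = K
  · subst h
    simp [SuperMat.zmod_add_self, ksign_zero]
  · rw [if_neg h]
    split_ifs with h1 h2
    · refine absurd (funext fun b => ?_) h
      by_cases hb : b = a
      · rw [hb, h2]
      · exact h1 b hb
    · simp
    · rfl

theorem SuperMat.placed_mul (a : Fin m) (X Y : SuperMat p A) :
    SuperMat.placed a X * SuperMat.placed a Y = SuperMat.placed a (X * Y) := by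
  refine SuperMat.ext fun L K => ?_
  rw [SuperMat.mul_apply, sum_eq_sum_update a K]
  · rw [SuperMat.placed_apply]
    split_ifs with h
    · rw [SuperMat.mul_apply, Finset.smul_sum]
      refine Finset.sum_congr rfl fun j _ => ?_
      have hJ : ∀ b, b ≠ a → Function.update K a j b = K b := fun b hb =>
        Function.update_of_ne hb _ _
      rw [tpar_add_tpar hJ, SuperMat.placed_apply, SuperMat.placed_apply,
        if_pos fun b hb => (h b hb).trans (hJ b hb).symm, if_pos hJ]
      have hs : ∑ b ∈ Finset.univ.filter (· < a), p (Function.update K a j b) =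
          ∑ b ∈ Finset.univ.filter (· < a), p (K b) :=
        Finset.sum_congr rfl fun b hb => by rw [hJ b (Finset.mem_filter.mp hb).2.ne]
      rw [hs, map_zsmul, smul_mul_smul_comm, ← ksign_add, Function.update_self, ← add_mul]
      congr 3
      linear_combination SuperMat.zmod_add_self (p j)
    · refine Finset.sum_eq_zero fun j _ => ?_
      rw [SuperMat.placed_apply, if_neg, map_zero, zero_mul]
      exact fun h' => h fun b hb => (h' b hb).trans (Function.update_of_ne hb _ _)
  · intro J hJ
    rw [SuperMat.placed_apply a Y, if_neg hJ, mul_zero]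

theorem SuperMat.prod_placed_apply_eq_zero (X : Fin m → SuperMat p A) (l : List (Fin m))
    (J K : Fin m → ι) {b : Fin m} (hb : b ∉ l) (h : J b ≠ K b) :
    (l.map fun a => SuperMat.placed a (X a)).prod J K = 0 := by
  induction l generalizing J with
  | nil =>
    rw [List.map_nil, List.prod_nil, SuperMat.one_apply, if_neg fun e => h (congrFun e b)]
  | cons a l ih =>
    rw [List.map_cons, List.prod_cons, SuperMat.mul_apply]
    refine Finset.sum_eq_zero fun I _ => ?_
    rw [List.mem_cons, not_or] at hb
    by_cases hI : J b = I b
    · rw [ih I hb.2 (hI ▸ h), mul_zero]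
    · rw [SuperMat.placed_apply, if_neg fun e => hI (e b hb.1), map_zero, zero_mul]

/-- Each place is visited at most once, so its factor must carry $J_a$ to $K_a$ directly and only
one chain of intermediate indices survives. All matrix units along it are even, which makes every
Koszul sign and every parity twist trivial. -/
theorem SuperMat.prod_placed_apply (X : Fin m → SuperMat p A) (l : List (Fin m)) (hl : l.Nodup)
    (J K : Fin m → ι) (hp : ∀ a, p (J a) = p (K a)) (hJK : ∀ b, b ∉ l → J b = K b) :
    (l.map fun a => SuperMat.placed a (X a)).prod J K = (l.map fun a => X a (J a) (K a)).prod := by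
  induction l generalizing J with
  | nil =>
    rw [List.map_nil, List.prod_nil, SuperMat.one_apply, if_pos (funext fun b => hJK b (by simp))]
    rfl
  | cons a l ih =>
    rw [List.nodup_cons] at hl
    rw [List.map_cons, List.prod_cons, SuperMat.mul_apply, List.map_cons, List.prod_cons,
      -- The first factor changes only place `a`, and no later factor can correct that place.
      Finset.sum_eq_single (Function.update J a (K a))]
    · have hJ : ∀ b, b ≠ a → Function.update J a (K a) b = J b := fun b hb =>
        Function.update_of_ne hb _ _
      have hp' : ∀ b, p (Function.update J a (K a) b) = p (K b) := fun b => by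
        by_cases hb : b = a
        · subst hb; rw [Function.update_self]
        · rw [hJ b hb, hp]
      rw [ih hl.2 _ hp', SuperMat.placed_apply, if_pos fun b hb => (hJ b hb).symm]
      · have ht : tpar p m (Function.update J a (K a)) = tpar p m K :=
          Finset.sum_congr rfl fun b _ => hp' b
        rw [ht, SuperMat.zmod_add_self, parityPow_zero, Function.update_self, hp,
          SuperMat.zmod_add_self, zero_mul, ksign_zero, one_smul]
        congr 2
        refine List.map_congr_left fun b hb => ?_
        rw [hJ b fun e => hl.1 (e ▸ hb)]
      · intro b hb
        by_cases hba : b = a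
        · subst hba; rw [Function.update_self]
        · rw [hJ b hba, hJK b (by simp [hba, hb])]
    · intro I _ hI
      by_cases h1 : ∀ b, b ≠ a → J b = I b
      · by_cases h2 : I a = K a
        · exact absurd (Function.eq_update_iff.mpr ⟨h2, fun b hb => (h1 b hb).symm⟩) hI
        · rw [SuperMat.prod_placed_apply_eq_zero X l I K hl.1 h2, mul_zero]
      · rw [SuperMat.placed_apply, if_neg h1, map_zero, zero_mul]
    · simp

theorem SuperMat.ofOp_mul_apply (x : Matrix ι ι ℂ) (Y : SuperMat p A) (i k : ι) :
    (SuperMat.ofOp x * Y : SuperMat p A) i k = ∑ j, x i j • Y j k := by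
  rw [SuperMat.mul_apply]
  refine Finset.sum_congr rfl fun j _ => ?_
  rw [SuperMat.ofOp, AlgHom.commutes, Algebra.smul_def]

/-- Evenness of `x` is needed here: an odd operator on the right would twist the entries of `Y` by
the parity automorphism. On the left no condition arises, since scalars are even. -/
theorem SuperMat.mul_ofOp_apply (x : Matrix ι ι ℂ) (hx : ∀ i j, x i j ≠ 0 → p i = p j)
    (Y : SuperMat p A) (i k : ι) :
    (Y * SuperMat.ofOp x : SuperMat p A) i k = ∑ j, x j k • Y i j := by
  rw [SuperMat.mul_apply]
  refine Finset.sum_congr rfl fun j _ => ?_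
  by_cases h : x j k = 0
  · simp [SuperMat.ofOp, h]
  · rw [hx j k h, SuperMat.zmod_add_self, parityPow_zero, SuperMat.ofOp, Algebra.smul_def,
      Algebra.commutes]

theorem superPerm_apply (p : ι → ZMod 2) (σ : Equiv.Perm (Fin m)) (L K : Fin m → ι) :
    superPerm p m σ L K = if L = K ∘ ⇑σ⁻¹ then (ksign (crossing p σ K) : ℂ) else 0 := rfl

theorem superPerm_tpar (p : ι → ZMod 2) (σ : Equiv.Perm (Fin m)) (L K : Fin m → ι)
    (h : superPerm p m σ L K ≠ 0) : tpar p m L = tpar p m K := by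
  rw [superPerm_apply] at h
  have hL : L = K ∘ ⇑σ⁻¹ := by
    by_contra hne
    exact h (if_neg hne)
  rw [hL]
  exact Equiv.sum_comp σ⁻¹ fun a => p (K a)

theorem shift_parityPow (c : ℂ) (q : ZMod 2) (f : A⟦X⟧) :
    parityPow q (shift c f) = shift c (parityPow q f) := by
  ext n
  rw [SuperMat.coeff_parityPow]
  simp only [shift, PowerSeries.coeff_mk, map_sum, map_smul, SuperMat.coeff_parityPow]

/-- The matrix `X(u + c)`. -/
noncomputable def SuperMat.shifted (c : ℂ) (X : SuperMat p A⟦X⟧) : SuperMat p A⟦X⟧ :=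
  fun i j => shift c (X i j)

theorem SuperMat.shifted_mul (c : ℂ) (X Y : SuperMat p A⟦X⟧) :
    (X * Y).shifted c = X.shifted c * Y.shifted c := by
  refine SuperMat.ext fun i k => ?_
  simp only [SuperMat.shifted, SuperMat.mul_apply]
  change shiftHom c _ = _
  rw [map_sum]
  refine Finset.sum_congr rfl fun j _ => ?_
  rw [shift_parityPow, ← shift_mul]
  rfl

theorem SuperMat.shifted_one (c : ℂ) : (1 : SuperMat p A⟦X⟧).shifted c = 1 := by
  refine SuperMat.ext fun i k => ?_
  simp only [SuperMat.shifted, SuperMat.one_apply]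
  split_ifs
  · exact shift_one c
  · exact map_zero (shiftHom c)

end Place

/-! ## The relations between the entries of `T(u)` and of its inverse -/

section Entries

variable {ι : Type*} [Fintype ι] [DecidableEq ι] {p : ι → ZMod 2} {m : ℕ}
variable {A : Type*} [Ring A] [Algebra ℂ A] [Superalgebra A]

theorem SuperMat.ofOp_superPerm_mul_apply (σ : Equiv.Perm (Fin m)) (Z : SuperMat (tpar p m) A)
    (L K : Fin m → ι) :
    (SuperMat.ofOp (superPerm p m σ) * Z : SuperMat (tpar p m) A) L K =
      ksign (crossing p σ (L ∘ σ)) • Z (L ∘ σ) K := by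
  rw [SuperMat.ofOp_mul_apply, Finset.sum_eq_single (L ∘ σ)]
  · rw [superPerm_apply, if_pos (by ext a; simp), Int.cast_smul_eq_zsmul]
  · intro J _ hJ
    rw [superPerm_apply, if_neg, zero_smul]
    rintro rfl
    exact hJ (by ext a; simp)
  · simp

theorem SuperMat.mul_ofOp_superPerm_apply (σ : Equiv.Perm (Fin m)) (Z : SuperMat (tpar p m) A)
    (L K : Fin m → ι) :
    (Z * SuperMat.ofOp (superPerm p m σ) : SuperMat (tpar p m) A) L K =
      ksign (crossing p σ K) • Z L (K ∘ ⇑σ⁻¹) := by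
  rw [SuperMat.mul_ofOp_apply _ (superPerm_tpar p σ), Finset.sum_eq_single (K ∘ ⇑σ⁻¹)]
  · rw [superPerm_apply, if_pos rfl, Int.cast_smul_eq_zsmul]
  · intro J _ hJ
    rw [superPerm_apply, if_neg hJ, zero_smul]
  · simp

theorem crossing_swap_pair (K : Fin 2 → ι) {q : ZMod 2} (h : ∀ a, p (K a) = q) :
    crossing p (Equiv.swap (0 : Fin 2) 1) K = q := by
  rw [crossing_swap p (by decide), h, h, SuperMat.zmod_add_self, zero_mul, add_zero]
  have : ∀ q : ZMod 2, q * q = q := by decide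
  exact this q

theorem SuperMat.superP_mul_apply (Z : SuperMat (tpar p 2) A) {q : ZMod 2} {i j k l : ι}
    (hi : p i = q) (hk : p k = q) :
    (SuperMat.ofOp (superP p (0 : Fin 2) 1) * Z : SuperMat (tpar p 2) A) ![i, k] ![j, l] =
      ksign q • Z ![k, i] ![j, l] := by
  have e : (![i, k] ∘ ⇑(Equiv.swap (0 : Fin 2) 1) : Fin 2 → ι) = ![k, i] := by
    ext a; fin_cases a <;> simp
  rw [← superPerm_swap p (by decide), SuperMat.ofOp_superPerm_mul_apply, e,
    crossing_swap_pair (q := q)]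
  intro a; fin_cases a <;> simp [hi, hk]

theorem SuperMat.mul_superP_apply (Z : SuperMat (tpar p 2) A) {q : ZMod 2} {i j k l : ι}
    (hj : p j = q) (hl : p l = q) :
    (Z * SuperMat.ofOp (superP p (0 : Fin 2) 1) : SuperMat (tpar p 2) A) ![i, k] ![j, l] =
      ksign q • Z ![i, k] ![l, j] := by
  have e : (![j, l] ∘ ⇑(Equiv.swap (0 : Fin 2) 1)⁻¹ : Fin 2 → ι) = ![l, j] := by
    ext a; fin_cases a <;> simp
  rw [← superPerm_swap p (by decide), SuperMat.mul_ofOp_superPerm_apply, e,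
    crossing_swap_pair (q := q)]
  intro a; fin_cases a <;> simp [hj, hl]

theorem SuperMat.placed_zero_mul_placed_one_apply (X Y : SuperMat p A) {q : ZMod 2} {i j k l : ι}
    (hi : p i = q) (hj : p j = q) (hk : p k = q) (hl : p l = q) :
    (SuperMat.placed (0 : Fin 2) X * SuperMat.placed 1 Y : SuperMat (tpar p 2) A) ![i, k] ![j, l] = X i j * Y k l := by
  have := SuperMat.prod_placed_apply ![X, Y] [0, 1] (by decide) ![i, k] ![j, l]
    (by intro a; fin_cases a <;> simp [hi, hj, hk, hl])
    (by intro a; fin_cases a <;> simp)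
  simpa using this

theorem SuperMat.placed_one_mul_placed_zero_apply (X Y : SuperMat p A) {q : ZMod 2} {i j k l : ι}
    (hi : p i = q) (hj : p j = q) (hk : p k = q) (hl : p l = q) :
    (SuperMat.placed (1 : Fin 2) Y * SuperMat.placed 0 X : SuperMat (tpar p 2) A) ![i, k] ![j, l] = Y k l * X i j := by
  have := SuperMat.prod_placed_apply ![X, Y] [1, 0] (by decide) ![i, k] ![j, l]
    (by intro a; fin_cases a <;> simp [hi, hj, hk, hl])
    (by intro a; fin_cases a <;> simp)
  simpa using this

theorem SuperMat.zsmul_apply (z : ℤ) (X : SuperMat p A) (i j : ι) : (z • X) i j = z • X i j := rfl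

/-- The coefficient of `u^{-r}` in `X(u)`. -/
noncomputable def SuperMat.coeffMat (r : ℕ) (F : SuperMat p A⟦X⟧) : SuperMat p A :=
  fun i j => PowerSeries.coeff r (F i j)

theorem SuperMat.shifted_mul_shifted_apply (c d : ℂ) (F G : SuperMat p A⟦X⟧) (i k : ι) :
    (F.shifted c * G.shifted d) i k =
      shiftTwo c d fun r s => (F.coeffMat r * G.coeffMat s) i k := by
  have h : (fun r s => (F.coeffMat r * G.coeffMat s) i k) =
      ∑ j, fun r s => parityPow (p j + p k) (F.coeffMat r i j) * G.coeffMat s j k := by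
    funext r s
    rw [Finset.sum_apply, Finset.sum_apply]
    rfl
  rw [h, map_sum, SuperMat.mul_apply]
  refine Finset.sum_congr rfl fun j _ => ?_
  rw [SuperMat.shifted, SuperMat.shifted, shift_parityPow, shift_mul_shift]
  simp only [SuperMat.coeff_parityPow]
  rfl

theorem SuperMat.shifted_mul_shifted_apply' (c d : ℂ) (F G : SuperMat p A⟦X⟧) (i k : ι) :
    (G.shifted d * F.shifted c) i k =
      shiftTwo c d fun r s => (G.coeffMat s * F.coeffMat r) i k := by
  rw [SuperMat.shifted_mul_shifted_apply, ← shiftTwo_swap]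

theorem SuperMat.placed_shifted (c : ℂ) (a : Fin m) (F : SuperMat p A⟦X⟧) :
    SuperMat.placed a (F.shifted c) = (SuperMat.placed a F).shifted c := by
  refine SuperMat.ext fun L K => ?_
  rw [SuperMat.shifted, SuperMat.placed_apply, SuperMat.placed_apply]
  split_ifs
  · exact (map_zsmul (shiftHom c) _ _).symm
  · exact (map_zero (shiftHom c)).symm

theorem SuperMat.coeffMat_placed (r : ℕ) (a : Fin m) (F : SuperMat p A⟦X⟧) :
    (SuperMat.placed a F).coeffMat r = SuperMat.placed a (F.coeffMat r) := by
  refine SuperMat.ext fun L K => ?_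
  rw [SuperMat.coeffMat, SuperMat.placed_apply, SuperMat.placed_apply]
  split_ifs
  · rw [map_zsmul, SuperMat.coeffMat]
  · rw [map_zero]

/-- When all four indices have parity $q$, the only sign left is $(-1)^q$, from $P$ exchanging two
vectors of that parity. $P$ on the left exchanges the row indices, $P$ on the right the column
indices. -/
theorem SuperMat.entries_of_rtt {X Y : SuperMat p A} {z : ℤ}
    (h : z • (SuperMat.placed (0 : Fin 2) X * SuperMat.placed 1 Y -
        SuperMat.placed 1 Y * SuperMat.placed 0 X) =
      SuperMat.ofOp (superP p 0 1) * (SuperMat.placed 0 X * SuperMat.placed 1 Y) -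
        SuperMat.placed 1 Y * SuperMat.placed 0 X * SuperMat.ofOp (superP p 0 1))
    {q : ZMod 2} {i j k l : ι} (hi : p i = q) (hj : p j = q) (hk : p k = q) (hl : p l = q) :
    z • (X i j * Y k l - Y k l * X i j) = ksign q • (X k j * Y i l - Y k j * X i l) := by
  have h := congrFun (congrFun h ![i, k]) ![j, l]
  rwa [SuperMat.zsmul_apply, SuperMat.sub_apply, SuperMat.sub_apply,
    SuperMat.superP_mul_apply _ hi hk, SuperMat.mul_superP_apply _ hj hl,
    SuperMat.placed_zero_mul_placed_one_apply _ _ hi hj hk hl,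
    SuperMat.placed_one_mul_placed_zero_apply _ _ hi hj hk hl,
    SuperMat.placed_zero_mul_placed_one_apply _ _ hk hj hi hl,
    SuperMat.placed_one_mul_placed_zero_apply _ _ hi hl hk hj, ← smul_sub] at h

theorem SuperMat.entries_of_rtt_inverse {X Y : SuperMat p A} {z : ℤ}
    (h : z • (SuperMat.placed (0 : Fin 2) X * SuperMat.placed 1 Y -
        SuperMat.placed 1 Y * SuperMat.placed 0 X) =
      SuperMat.placed 0 X * SuperMat.placed 1 Y * SuperMat.ofOp (superP p 0 1) -
        SuperMat.ofOp (superP p 0 1) * (SuperMat.placed 1 Y * SuperMat.placed 0 X))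
    {q : ZMod 2} {i j k l : ι} (hi : p i = q) (hj : p j = q) (hk : p k = q) (hl : p l = q) :
    z • (X i j * Y k l - Y k l * X i j) = ksign q • (X i l * Y k j - Y i l * X k j) := by
  have h := congrFun (congrFun h ![i, k]) ![j, l]
  rwa [SuperMat.zsmul_apply, SuperMat.sub_apply, SuperMat.sub_apply,
    SuperMat.superP_mul_apply _ hi hk, SuperMat.mul_superP_apply _ hj hl,
    SuperMat.placed_zero_mul_placed_one_apply _ _ hi hj hk hl,
    SuperMat.placed_one_mul_placed_zero_apply _ _ hi hj hk hl,
    SuperMat.placed_zero_mul_placed_one_apply _ _ hi hl hk hj,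
    SuperMat.placed_one_mul_placed_zero_apply _ _ hk hj hi hl, ← smul_sub] at h

variable {B : Type*} [Ring B] [Algebra ℂ B] [Superalgebra B]

/-- The homomorphism `1 ⊗ φ` for an even homomorphism `φ`. -/
def SuperMat.mapHom (p : ι → ZMod 2) (φ : A →ₐ[ℂ] B)
    (hφ : ∀ a, φ (Superalgebra.parity a) = Superalgebra.parity (φ a)) :
    SuperMat p A →+* SuperMat p B where
  toFun X i j := φ (X i j)
  map_one' := by
    refine SuperMat.ext fun i j => ?_
    rw [SuperMat.one_apply, SuperMat.one_apply]
    split_ifs <;> simp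
  map_mul' X Y := by
    refine SuperMat.ext fun i k => ?_
    change φ ((X * Y) i k) = ∑ j, parityPow (p j + p k) (φ (X i j)) * φ (Y j k)
    rw [SuperMat.mul_apply, map_sum]
    refine Finset.sum_congr rfl fun j _ => ?_
    rw [map_mul]
    congr 1
    unfold parityPow
    split_ifs
    · rfl
    · exact hφ _
  map_zero' := by
    refine SuperMat.ext fun i j => ?_
    rw [SuperMat.zero_apply, SuperMat.zero_apply, map_zero]
  map_add' X Y := by
    refine SuperMat.ext fun i j => ?_
    exact map_add φ _ _

end Entries

/-! ### Exchange relations for $T(u)$ and $T(u)^{-1}$ at an integer difference of spectral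
parameters -/

section Relations

variable (M N : ℕ)

theorem mkAlgHom_parity (a : FreeAlgebra ℂ (YGen M N)) :
    RingQuot.mkAlgHom ℂ (YRel M N) (Superalgebra.parity a) =
      Superalgebra.parity (RingQuot.mkAlgHom ℂ (YRel M N) a) := by
  change _ = RingQuot.liftAlgHom ℂ _ _
  rw [RingQuot.liftAlgHom_mkAlgHom_apply]
  rfl

/-- The quotient map from the free algebra commutes with parity, so it induces a ring homomorphism
on supermatrices and carries the imposed entrywise relations to matrix relations. -/
theorem rtt_coeff (r s : ℕ) :
    SuperMat.placed (0 : Fin 2) (coeffT M N (r + 1)) * SuperMat.placed 1 (coeffT M N s) -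
      SuperMat.placed 0 (coeffT M N r) * SuperMat.placed 1 (coeffT M N (s + 1)) -
      SuperMat.ofOp (superP (par M N) 0 1) *
        (SuperMat.placed 0 (coeffT M N r) * SuperMat.placed 1 (coeffT M N s)) =
    SuperMat.placed 1 (coeffT M N s) * SuperMat.placed (0 : Fin 2) (coeffT M N (r + 1)) -
      SuperMat.placed 1 (coeffT M N (s + 1)) * SuperMat.placed 0 (coeffT M N r) -
      SuperMat.placed 1 (coeffT M N s) * SuperMat.placed 0 (coeffT M N r) *
        SuperMat.ofOp (superP (par M N) 0 1) := by
  set φ := SuperMat.mapHom (tpar (par M N) 2) (RingQuot.mkAlgHom ℂ (YRel M N))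
    (mkAlgHom_parity M N)
  have hT : ∀ (a : Fin 2) (r : ℕ), φ (freeTAt M N a r) = SuperMat.placed a (coeffT M N r) := by
    intro a r
    refine SuperMat.ext fun L K => ?_
    change RingQuot.mkAlgHom ℂ (YRel M N) (SuperMat.placed a (freeT M N r) L K) = _
    rw [SuperMat.placed_apply, SuperMat.placed_apply]
    split_ifs
    · exact map_zsmul _ _ _
    · exact map_zero _
  have hP : φ (freeP M N) = SuperMat.ofOp (superP (par M N) 0 1) := by
    refine SuperMat.ext fun L K => ?_
    exact AlgHom.commutes _ _
  have h : φ (rttLeft M N r s) = φ (rttRight M N r s) := by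
    refine SuperMat.ext fun L K => ?_
    exact RingQuot.mkAlgHom_rel ℂ (YRel.rtt r s L K)
  simpa only [rttLeft, rttRight, map_sub, map_mul, hT, hP] using h

theorem coeffMat_T (r : ℕ) : (T M N).coeffMat r = coeffT M N r :=
  SuperMat.ext fun _ _ => PowerSeries.coeff_mk _ _

theorem coeffT_zero : coeffT M N 0 = 1 := by
  refine SuperMat.ext fun i j => ?_
  simp only [coeffT, freeT, SuperMat.one_apply]
  split_ifs <;> simp

/-- This is $(u-v)R(u-v)T_1T_2=(u-v)T_2T_1R(u-v)$ along the line $u-v=c-d$. The commutator has no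
terms of degree zero in either variable because $T^{(0)}=1$, which is what `zsmul_shiftTwo`
requires. -/
theorem rtt_shifted (c d : ℂ) (z : ℤ) (hz : c - d = z) :
    z • (SuperMat.placed (0 : Fin 2) ((T M N).shifted c) * SuperMat.placed 1 ((T M N).shifted d) -
      SuperMat.placed 1 ((T M N).shifted d) * SuperMat.placed 0 ((T M N).shifted c)) =
    SuperMat.ofOp (superP (par M N) 0 1) *
      (SuperMat.placed 0 ((T M N).shifted c) * SuperMat.placed 1 ((T M N).shifted d)) -
    SuperMat.placed 1 ((T M N).shifted d) * SuperMat.placed 0 ((T M N).shifted c) *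
      SuperMat.ofOp (superP (par M N) 0 1) := by
  refine SuperMat.ext fun L K => ?_
  set t : Fin 2 → ℕ → SuperMat (tpar (par M N) 2) (Yangian M N) := fun a r =>
    SuperMat.placed a (coeffT M N r) with ht
  have ht0 : ∀ a, t a 0 = 1 := fun a => by
    simp only [ht, coeffT_zero, SuperMat.placed_one]
  set g : ℕ → ℕ → SuperMat (tpar (par M N) 2) (Yangian M N) := fun r s =>
    t 0 r * t 1 s - t 1 s * t 0 r with hg
  set k : ℕ → ℕ → SuperMat (tpar (par M N) 2) (Yangian M N) := fun r s =>
    SuperMat.ofOp (superP (par M N) 0 1) * (t 0 r * t 1 s) -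
      t 1 s * t 0 r * SuperMat.ofOp (superP (par M N) 0 1) with hk
  have hgk : ∀ r s, g (r + 1) s - g r (s + 1) = k r s := fun r s => by
    have := rtt_coeff M N r s
    rw [← sub_eq_zero] at this ⊢
    rw [← this]
    simp only [hg, hk, ht]
    abel
  have key := zsmul_shiftTwo c d z hz (fun r s => g r s L K) (fun r s => k r s L K)
    (fun s => by simp only [hg, ht0, one_mul, mul_one, sub_self, SuperMat.zero_apply])
    (fun r => by simp only [hg, ht0, one_mul, mul_one, sub_self, SuperMat.zero_apply])
    (fun r s => by rw [← SuperMat.sub_apply, hgk])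
  rw [SuperMat.zsmul_apply, SuperMat.sub_apply, SuperMat.sub_apply, SuperMat.ofOp_mul_apply,
    SuperMat.mul_ofOp_apply _ (superP_even (par M N))]
  simp only [SuperMat.placed_shifted, SuperMat.shifted_mul_shifted_apply,
    SuperMat.shifted_mul_shifted_apply' c d, ← map_smul, ← map_sum, ← map_sub,
    SuperMat.coeffMat_placed, coeffMat_T]
  refine key.trans (congrArg _ ?_)
  funext r s
  simp only [hk]
  rw [SuperMat.sub_apply, SuperMat.ofOp_mul_apply,
    SuperMat.mul_ofOp_apply _ (superP_even (par M N))]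
  simp [ht]

theorem placed_shifted_T_mul_Tinv (m : ℕ) (a : Fin m) (c : ℂ) :
    SuperMat.placed a ((T M N).shifted c) * SuperMat.placed a ((Tinv M N).shifted c) = 1 := by
  rw [SuperMat.placed_mul, ← SuperMat.shifted_mul, Tinv, Ring.mul_inverse_cancel _ (isUnit_T M N),
    SuperMat.shifted_one, SuperMat.placed_one]

theorem placed_shifted_Tinv_mul_T (m : ℕ) (a : Fin m) (c : ℂ) :
    SuperMat.placed a ((Tinv M N).shifted c) * SuperMat.placed a ((T M N).shifted c) = 1 := by
  rw [SuperMat.placed_mul, ← SuperMat.shifted_mul, Tinv, Ring.inverse_mul_cancel _ (isUnit_T M N),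
    SuperMat.shifted_one, SuperMat.placed_one]

theorem zsmul_sub_eq_of_inverse {R : Type*} [Ring R] {a b a' b' P : R} {z : ℤ}
    (ha : a * a' = 1) (ha' : a' * a = 1) (hb : b * b' = 1) (hb' : b' * b = 1)
    (h : z • (a * b - b * a) = P * (a * b) - b * a * P) :
    z • (a' * b' - b' * a') = a' * b' * P - P * (b' * a') := by
  have h1 : a * b * (b' * a') = 1 := by
    rw [mul_assoc, ← mul_assoc b, hb, one_mul, ha]
  have h2 : a' * b' * (b * a) = 1 := by
    rw [mul_assoc, ← mul_assoc b', hb', one_mul, ha']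
  -- Conjugation by the inverses: $a'b'$ cancels $ba$ and $b'a'$ cancels $ab$, so $P$ moves to the
  -- opposite sides.
  have := congrArg (fun x => a' * b' * x * (b' * a')) h
  simp only [mul_smul_comm, smul_mul_assoc, mul_sub, sub_mul] at this
  rwa [mul_assoc (a' * b') (a * b), h1, mul_one, h2, one_mul, mul_assoc (a' * b') (P * (a * b)),
    mul_assoc P, h1, mul_one, ← mul_assoc (a' * b'), h2, one_mul] at this

theorem rtt_shifted_inverse (c d : ℂ) (z : ℤ) (hz : c - d = z) :
    z • (SuperMat.placed (0 : Fin 2) ((Tinv M N).shifted c) *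
        SuperMat.placed 1 ((Tinv M N).shifted d) -
      SuperMat.placed 1 ((Tinv M N).shifted d) * SuperMat.placed 0 ((Tinv M N).shifted c)) =
    SuperMat.placed 0 ((Tinv M N).shifted c) * SuperMat.placed 1 ((Tinv M N).shifted d) *
      SuperMat.ofOp (superP (par M N) 0 1) -
    SuperMat.ofOp (superP (par M N) 0 1) *
      (SuperMat.placed 1 ((Tinv M N).shifted d) * SuperMat.placed 0 ((Tinv M N).shifted c)) :=
  zsmul_sub_eq_of_inverse (placed_shifted_T_mul_Tinv M N 2 0 c)
    (placed_shifted_Tinv_mul_T M N 2 0 c) (placed_shifted_T_mul_Tinv M N 2 1 d)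
    (placed_shifted_Tinv_mul_T M N 2 1 d) (rtt_shifted M N c d z hz)

variable {M N}

theorem T_entries_even {i j k l : Fin (M + N)} (hi : par M N i = 0) (hj : par M N j = 0)
    (hk : par M N k = 0) (hl : par M N l = 0) {c d : ℂ} (hcd : c - d = 1) :
    shift c (T M N i j) * shift d (T M N k l) - shift d (T M N k l) * shift c (T M N i j) =
      shift c (T M N k j) * shift d (T M N i l) - shift d (T M N k j) * shift c (T M N i l) := by
  have h := SuperMat.entries_of_rtt (rtt_shifted M N c d 1 (by simpa using hcd)) hi hj hk hl
  rw [one_zsmul, ksign_zero, one_zsmul] at h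
  exact h

theorem Tinv_entries_odd {i j k l : Fin (M + N)} (hi : par M N i = 1) (hj : par M N j = 1)
    (hk : par M N k = 1) (hl : par M N l = 1) {c d : ℂ} (hcd : c - d = -1) :
    shift c (Tinv M N i j) * shift d (Tinv M N k l) -
        shift d (Tinv M N k l) * shift c (Tinv M N i j) =
      shift c (Tinv M N i l) * shift d (Tinv M N k j) -
        shift d (Tinv M N i l) * shift c (Tinv M N k j) := by
  have h := SuperMat.entries_of_rtt_inverse (rtt_shifted_inverse M N c d (-1) (by simpa using hcd))
    hi hj hk hl
  have h1 : ksign 1 = -1 := by decide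
  -- The difference $-1$ of the parameters cancels the sign $(-1)^q=-1$ of the odd indices. This is
  -- why the shifts ascend in the odd part and descend in the even part.
  rw [h1, neg_one_zsmul, neg_one_zsmul, neg_inj] at h
  exact h

end Relations

/-! ## Alternating sums -/

section Alternating

variable {n : ℕ} {κ A : Type*} [Ring A]

/-- The sign of a map that is a permutation, and zero otherwise. -/
def mapSign (K : Fin n → Fin n) : ℤ :=
  ∑ σ : Equiv.Perm (Fin n), if K = σ then (Equiv.Perm.sign σ : ℤ) else 0

theorem mapSign_coe (σ : Equiv.Perm (Fin n)) : mapSign σ = Equiv.Perm.sign σ := by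
  unfold mapSign
  rw [Finset.sum_eq_single σ]
  · simp
  · intro τ _ h
    rw [if_neg fun e => h (DFunLike.coe_injective e).symm]
  · simp

theorem mapSign_of_not_injective {K : Fin n → Fin n} (h : ¬ Function.Injective K) :
    mapSign K = 0 := by
  refine Finset.sum_eq_zero fun σ _ => if_neg ?_
  rintro rfl
  exact h σ.injective

/-- An alternating function of $n$ indices from an $n$-element set is determined by its value at the
identity. With a repeated index, a transposition fixes the argument and negates the value, which is
then zero in the absence of 2-torsion. -/
theorem eq_mapSign_smul {R : Type*} [AddCommGroup R] (hR : ∀ x : R, x + x = 0 → x = 0)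
    (f : (Fin n → Fin n) → R)
    (hf : ∀ K (σ : Equiv.Perm (Fin n)), f (K ∘ σ) = (Equiv.Perm.sign σ : ℤ) • f K)
    (K : Fin n → Fin n) : f K = mapSign K • f id := by
  by_cases h : Function.Injective K
  · obtain ⟨σ, rfl⟩ : ∃ σ : Equiv.Perm (Fin n), K = σ :=
      ⟨Equiv.ofBijective K (Finite.injective_iff_bijective.mp h), rfl⟩
    rw [mapSign_coe, ← hf, Function.id_comp]
  · rw [mapSign_of_not_injective h, zero_smul]
    rw [Function.Injective] at h
    push Not at h
    obtain ⟨a, b, hab, hne⟩ := h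
    have e : K ∘ Equiv.swap a b = K := by
      funext c
      rw [Function.comp_apply, Equiv.swap_apply_def]
      split_ifs with h1 h2
      · rw [h1, hab]
      · rw [h2, hab]
      · rfl
    have := hf K (Equiv.swap a b)
    rw [e, Equiv.Perm.sign_swap hne, Units.val_neg, Units.val_one, neg_one_smul] at this
    refine hR _ ?_
    nth_rewrite 1 [this]
    exact neg_add_cancel _

/-- The sum `∑ sgn σ F_1(L σ(1), K 1) ⋯ F_n(L σ(n), K n)`. -/
def altSum (F : Fin n → κ → κ → A) (L K : Fin n → κ) : A :=
  ∑ σ : Equiv.Perm (Fin n), (Equiv.Perm.sign σ : ℤ) •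
    (List.ofFn fun a => F a (L (σ a)) (K a)).prod

/-- Antisymmetry in the rows is a reindexing and needs no commutation relation, unlike antisymmetry
in the columns. -/
theorem altSum_comp_left (F : Fin n → κ → κ → A) (L K : Fin n → κ) (ρ : Equiv.Perm (Fin n)) :
    altSum F (L ∘ ρ) K = (Equiv.Perm.sign ρ : ℤ) • altSum F L K := by
  unfold altSum
  rw [Finset.smul_sum]
  symm
  rw [← Equiv.sum_comp (Equiv.mulLeft ρ)]
  refine Finset.sum_congr rfl fun σ _ => ?_
  rw [smul_smul]
  have h : (Equiv.Perm.sign ρ : ℤ) * (Equiv.Perm.sign (Equiv.mulLeft ρ σ) : ℤ) =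
      Equiv.Perm.sign σ := by
    rw [Equiv.coe_mulLeft, Equiv.Perm.sign_mul, Units.val_mul, ← mul_assoc, ← Units.val_mul,
      Int.units_mul_self, Units.val_one, one_mul]
  rw [h]
  rfl

/-- Isolates two neighbouring factors. `P` and `S` come before `g`, so the four products compared in
`altSum_comp_swap` share them. -/
theorem exists_prod_ofFn_eq (f : Fin (n + 1) → A) (a : Fin n) :
    ∃ P S : A, ∀ g : Fin (n + 1) → A, (∀ b, b ≠ a.castSucc → b ≠ a.succ → g b = f b) →
      (List.ofFn g).prod = P * (g a.castSucc * g a.succ) * S := by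
  induction n with
  | zero => exact a.elim0
  | succ n ih =>
    refine Fin.cases ?_ (fun a => ?_) a
    · refine ⟨1, (List.ofFn fun b : Fin n => f b.succ.succ).prod, fun g hg => ?_⟩
      rw [List.ofFn_succ, List.ofFn_succ, List.prod_cons, List.prod_cons, one_mul, mul_assoc]
      congr 4
      funext b
      exact hg _ (Fin.succ_ne_zero _) fun e => Fin.succ_ne_zero _ (Fin.succ_injective _ e)
    · obtain ⟨P, S, h⟩ := ih (fun b => f b.succ) a
      refine ⟨f 0 * P, S, fun g hg => ?_⟩
      rw [List.ofFn_succ, List.prod_cons, h fun b => g b.succ,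
        hg 0 (by rw [Fin.castSucc_succ]; exact (Fin.succ_ne_zero _).symm)
          (Fin.succ_ne_zero _).symm]
      · simp only [mul_assoc, Fin.castSucc_succ]
      · intro b h1 h2
        refine hg _ (fun e => h1 (Fin.succ_injective _ ?_)) fun e => h2 (Fin.succ_injective _ e)
        rw [e, Fin.castSucc_succ]

theorem altSum_comp_swap (hA : ∀ x : A, x + x = 0 → x = 0) (F : Fin (n + 1) → κ → κ → A)
    (hF : ∀ (a : Fin n) (i k j l : κ),
      F a.castSucc i j * F a.succ k l - F a.castSucc k j * F a.succ i l +
        (F a.castSucc i l * F a.succ k j - F a.castSucc k l * F a.succ i j) = 0)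
    (L K : Fin (n + 1) → κ) (a : Fin n) :
    altSum F L (K ∘ Equiv.swap a.castSucc a.succ) = - altSum F L K := by
  set s := Equiv.swap a.castSucc a.succ with hs
  have hne : a.castSucc ≠ a.succ := (Fin.castSucc_lt_succ).ne
  rw [eq_neg_iff_add_eq_zero]
  refine hA _ ?_
  have hsum : ∀ K, altSum F L K = ∑ σ : Equiv.Perm (Fin (n + 1)), -((Equiv.Perm.sign σ : ℤ) •
      (List.ofFn fun b => F b (L (σ (s b))) (K b)).prod) := by
    intro K
    unfold altSum
    rw [← Equiv.sum_comp (Equiv.mulRight s)]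
    refine Finset.sum_congr rfl fun σ _ => ?_
    rw [Equiv.coe_mulRight, Equiv.Perm.sign_mul, hs, Equiv.Perm.sign_swap hne, mul_neg, mul_one,
      Units.val_neg, neg_smul]
    rfl
  -- The sum to be killed is doubled, and its second copy is reindexed by $\sigma\mapsto\sigma s$.
  -- For each $\sigma$ the four resulting products are then exactly those of `hF`.
  nth_rewrite 2 [hsum, hsum]
  simp only [altSum, ← Finset.sum_add_distrib]
  refine Finset.sum_eq_zero fun σ _ => ?_
  obtain ⟨P, S, h⟩ := exists_prod_ofFn_eq (fun b => F b (L (σ b)) (K b)) a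
  have hb : ∀ b, b ≠ a.castSucc → b ≠ a.succ → s b = b := fun b h1 h2 =>
    Equiv.swap_apply_of_ne_of_ne h1 h2
  have s1 : s a.castSucc = a.succ := Equiv.swap_apply_left _ _
  have s2 : s a.succ = a.castSucc := Equiv.swap_apply_right _ _
  rw [h (fun b => F b (L (σ b)) (K b)) fun _ _ _ => rfl,
    h (fun b => F b (L (σ b)) ((K ∘ s) b)) fun b h1 h2 => by rw [Function.comp_apply, hb b h1 h2],
    h (fun b => F b (L (σ (s b))) (K b)) fun b h1 h2 => by rw [hb b h1 h2],
    h (fun b => F b (L (σ (s b))) ((K ∘ s) b)) fun b h1 h2 => by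
      rw [Function.comp_apply, hb b h1 h2]]
  simp only [Function.comp_apply, s1, s2]
  have := hF a (L (σ a.castSucc)) (L (σ a.succ)) (K a.castSucc) (K a.succ)
  rw [← smul_neg, ← smul_neg, ← smul_add, ← smul_add, ← smul_add]
  have e : ∀ x y z w : A, x - y + (z - w) = 0 →
      P * z * S + -(P * y * S) + (-(P * w * S) + P * x * S) = 0 := by
    intro x y z w hxyz
    calc _ = P * (x - y + (z - w)) * S := by noncomm_ring
      _ = 0 := by rw [hxyz, mul_zero, zero_mul]
  rw [e _ _ _ _ this, smul_zero]

theorem altSum_comp_right (hA : ∀ x : A, x + x = 0 → x = 0) (F : Fin n → κ → κ → A)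
    (hF : ∀ (a b : Fin n), a.val + 1 = b.val → ∀ i k j l : κ,
      F a i j * F b k l - F a k j * F b i l + (F a i l * F b k j - F a k l * F b i j) = 0)
    (L K : Fin n → κ) (ρ : Equiv.Perm (Fin n)) :
    altSum F L (K ∘ ρ) = (Equiv.Perm.sign ρ : ℤ) • altSum F L K := by
  cases n with
  | zero => rw [Subsingleton.elim ρ 1]; simp
  | succ n =>
    have hρ : ρ ∈ Submonoid.closure
        (Set.range fun i : Fin n => Equiv.swap i.castSucc i.succ) := by
      rw [Equiv.Perm.mclosure_swap_castSucc_succ]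
      trivial
    induction hρ using Submonoid.closure_induction generalizing K with
    | mem x h =>
      obtain ⟨a, rfl⟩ := h
      rw [altSum_comp_swap hA F (fun a => hF _ _ (by simp)),
        Equiv.Perm.sign_swap (Fin.castSucc_lt_succ).ne]
      simp
    | one => simp
    | mul x y _ _ hx hy =>
      rw [Equiv.Perm.coe_mul, ← Function.comp_assoc, hy, hx, smul_smul, ← Units.val_mul,
        ← Equiv.Perm.sign_mul, Equiv.Perm.sign_mul, Equiv.Perm.sign_mul, mul_comm]

theorem altSum_id_eq (hA : ∀ x : A, x + x = 0 → x = 0) (F : Fin n → Fin n → Fin n → A)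
    (hF : ∀ (a b : Fin n), a.val + 1 = b.val → ∀ i k j l : Fin n,
      F a i j * F b k l - F a k j * F b i l + (F a i l * F b k j - F a k l * F b i j) = 0)
    (K : Fin n → Fin n) : altSum F id K = mapSign K • altSum F id id :=
  eq_mapSign_smul hA (altSum F id) (fun K σ => altSum_comp_right hA F hF id K σ) K

theorem prod_ofFn_ite (P : Fin n → Prop) [DecidablePred P] :
    (List.ofFn fun a => if P a then (1 : A) else 0).prod = if ∀ a, P a then 1 else 0 := by
  induction n with
  | zero => simp
  | succ n ih =>
    rw [List.ofFn_succ, List.prod_cons, ih]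
    simp only [Fin.forall_fin_succ]
    by_cases h : P 0 <;> simp [h]

theorem altSum_delta [DecidableEq κ] (L K : Fin n → κ) :
    altSum (fun _ i j => if i = j then (1 : A) else 0) L K =
      ∑ σ : Equiv.Perm (Fin n), if L ∘ σ = K then ((Equiv.Perm.sign σ : ℤ) : A) else 0 := by
  refine Finset.sum_congr rfl fun σ _ => ?_
  rw [prod_ofFn_ite fun a => L (σ a) = K a, zsmul_eq_mul, mul_ite, mul_one, mul_zero]
  simp only [funext_iff, Function.comp_apply]

theorem altSum_delta_id :
    altSum (fun _ i j => if i = j then (1 : A) else 0) (id : Fin n → Fin n) id = 1 := by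
  rw [altSum_delta, Finset.sum_eq_single 1]
  · simp
  · intro σ _ h
    exact if_neg fun e => h (DFunLike.coe_injective e)
  · simp

/-- The left side is the alternating sum of Kronecker deltas, a scalar determinant. It alternates in
rows and columns separately and equals $1$ at the identity, so it factors. -/
theorem sum_sign_comp_eq (L K : Fin n → Fin n) :
    (∑ σ : Equiv.Perm (Fin n), if L ∘ σ = K then ((Equiv.Perm.sign σ : ℤ) : ℂ) else 0) =
      mapSign L * mapSign K := by
  have h2 : ∀ x : ℂ, x + x = 0 → x = 0 := fun x hx => by simpa using hx
  rw [← altSum_delta, eq_mapSign_smul h2 (fun L => altSum _ L K)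
    (fun L σ => altSum_comp_left _ L K σ) L, altSum_id_eq h2, altSum_delta_id]
  · simp
  · intro a b _ i k j l
    ring

theorem map_altSum {B : Type*} [Ring B] (φ : A →+* B) (F : Fin n → κ → κ → A) (L K : Fin n → κ) :
    φ (altSum F L K) = altSum (fun a i j => φ (F a i j)) L K := by
  unfold altSum
  rw [map_sum]
  refine Finset.sum_congr rfl fun σ _ => ?_
  rw [map_zsmul, map_list_prod, List.map_ofFn]
  rfl

end Alternating

/-! ## The operators `ℑ` and `A^{(M|N)}` -/

section Symmetrizers

variable {ι : Type*} [Fintype ι] [DecidableEq ι] {p : ι → ZMod 2} {m : ℕ}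

theorem ksign_crossing_of_even (σ : Equiv.Perm (Fin m)) {K : Fin m → ι} (hK : ∀ a, p (K a) = 0) :
    ksign (crossing p σ K) = 1 := by
  simp [crossing, hK, ksign_zero]

/-- For odd vectors each inversion contributes $-1$. The proof uses the cocycle rule `crossing_mul`
and the fact that a transposition contributes $-1$: each odd vector strictly between the two places
is crossed twice. -/
theorem ksign_crossing_of_odd (σ : Equiv.Perm (Fin m)) {K : Fin m → ι} (hK : ∀ a, p (K a) = 1) :
    ksign (crossing p σ K) = Equiv.Perm.sign σ := by
  have h1 : ksign 1 = -1 := by decide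
  have hswap : ∀ (x y : Fin m) (J : Fin m → ι), x < y → (∀ a, p (J a) = 1) →
      ksign (crossing p (Equiv.swap x y) J) = -1 := fun x y J hxy hJ => by
    rw [crossing_swap p hxy, hJ, hJ, SuperMat.zmod_add_self, zero_mul, add_zero, mul_one, h1]
  induction σ using Equiv.Perm.swap_induction_on with
  | one => simp [crossing_one, ksign_zero]
  | swap_mul σ x y hxy ih =>
    rw [crossing_mul, ksign_add, ih, Equiv.Perm.sign_mul, Equiv.Perm.sign_swap hxy]
    rcases lt_or_gt_of_ne hxy with h | h
    · rw [hswap x y (K ∘ ⇑σ⁻¹) h fun a => hK _]; simp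
    · rw [Equiv.swap_comm, hswap y x (K ∘ ⇑σ⁻¹) h fun a => hK _]; simp

theorem eq_comp_inv_iff (σ : Equiv.Perm (Fin m)) (L K : Fin m → ι) :
    L = K ∘ ⇑σ⁻¹ ↔ L ∘ σ = K := by
  constructor
  · rintro rfl
    ext a; simp
  · rintro rfl
    ext a; simp

theorem antisymmetrizer_apply {L : Fin m → ι} (hL : ∀ a, p (L a) = 0) (K : Fin m → ι) :
    antisymmetrizer p m L K =
      ∑ σ : Equiv.Perm (Fin m), if L ∘ σ = K then ((Equiv.Perm.sign σ : ℤ) : ℂ) else 0 := by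
  rw [antisymmetrizer, Matrix.sum_apply]
  refine Finset.sum_congr rfl fun σ _ => ?_
  rw [Matrix.smul_apply, superPerm_apply]
  simp only [eq_comp_inv_iff]
  split_ifs with h
  · subst h
    rw [ksign_crossing_of_even (K := L ∘ σ) σ fun a => hL _]
    simp
  · simp

/-- The crossing signs of odd vectors turn the symmetrizer into the same signed sum that the
antisymmetrizer gives on even vectors. -/
theorem symmetrizer_apply {L : Fin m → ι} (hL : ∀ a, p (L a) = 1) (K : Fin m → ι) :
    symmetrizer p m L K =
      ∑ σ : Equiv.Perm (Fin m), if L ∘ σ = K then ((Equiv.Perm.sign σ : ℤ) : ℂ) else 0 := by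
  rw [symmetrizer, Matrix.sum_apply]
  refine Finset.sum_congr rfl fun σ _ => ?_
  rw [superPerm_apply]
  simp only [eq_comp_inv_iff]
  split_ifs with h
  · subst h
    rw [ksign_crossing_of_odd (K := L ∘ σ) σ fun a => hL _]
  · rfl

theorem exists_comp_eq_of_antisymmetrizer_ne_zero {L K : Fin m → ι}
    (h : antisymmetrizer p m L K ≠ 0) : ∃ σ : Equiv.Perm (Fin m), L ∘ σ = K := by
  rw [antisymmetrizer, Matrix.sum_apply] at h
  obtain ⟨σ, -, hσ⟩ := Finset.exists_ne_zero_of_sum_ne_zero h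
  refine ⟨σ, ?_⟩
  by_contra hne
  rw [Matrix.smul_apply, superPerm_apply, if_neg fun e => hne ((eq_comp_inv_iff σ L K).mp e),
    smul_zero] at hσ
  exact hσ rfl

theorem exists_comp_eq_of_symmetrizer_ne_zero {L K : Fin m → ι}
    (h : symmetrizer p m L K ≠ 0) : ∃ σ : Equiv.Perm (Fin m), L ∘ σ = K := by
  rw [symmetrizer, Matrix.sum_apply] at h
  obtain ⟨σ, -, hσ⟩ := Finset.exists_ne_zero_of_sum_ne_zero h
  refine ⟨σ, ?_⟩
  by_contra hne
  rw [superPerm_apply, if_neg fun e => hne ((eq_comp_inv_iff σ L K).mp e)] at hσ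
  exact hσ rfl

theorem place_diagonal (p : ι → ZMod 2) (a : Fin m) (d : ι → ℂ) :
    place p a (Matrix.diagonal d) = Matrix.diagonal fun K => d (K a) := by
  ext L K
  rw [place, Matrix.of_apply, Matrix.diagonal_apply, Matrix.diagonal_apply]
  by_cases h : L = K
  · subst h
    simp [SuperMat.zmod_add_self, ksign_zero]
  · rw [if_neg h]
    split_ifs with h1 h2
    · refine absurd (funext fun b => ?_) h
      by_cases hb : b = a
      · rw [hb, h2]
      · exact h1 b hb
    · simp
    · rfl

end Symmetrizers

/-! ### The image of $\Im$ and the rank-one form of $\Im A^{(M|N)}$ -/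

section Mixed

variable (M N : ℕ)

/-- The basis vectors of the image of `ℑ`. -/
def IsMixed (K : Fin (M + N) → Fin (M + N)) : Prop :=
  (∀ a : Fin M, par M N (K (Fin.castAdd N a)) = 0) ∧ ∀ b : Fin N, par M N (K (Fin.natAdd M b)) = 1

instance : DecidablePred (IsMixed M N) := fun _ => inferInstanceAs (Decidable (_ ∧ _))

theorem projMixed_eq :
    projMixed M N = Matrix.diagonal fun K => if IsMixed M N K then (1 : ℂ) else 0 := by
  have h : ∀ a : Fin (M + N),
      place (par M N) a (if a.val < M then projEven M N else projOdd M N) =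
        Matrix.diagonalRingHom (Fin (M + N) → Fin (M + N)) ℂ fun K =>
          if (if a.val < M then par M N (K a) = 0 else par M N (K a) = 1) then 1 else 0 := by
    intro a
    split_ifs
    · exact place_diagonal _ _ _
    · exact place_diagonal _ _ _
  unfold projMixed
  simp only [h]
  rw [← Function.comp_def (Matrix.diagonalRingHom (Fin (M + N) → Fin (M + N)) ℂ),
    ← List.map_ofFn, ← map_list_prod, List.prod_ofFn]
  change Matrix.diagonal _ = _
  congr 1
  funext K
  rw [Finset.prod_apply, Fin.prod_univ_add]
  simp only [Fin.val_castAdd, Fin.val_natAdd, Fin.is_lt, if_true, Finset.prod_boole,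
    Finset.mem_univ, forall_const, not_lt_of_ge (Nat.le_add_right M _), if_false]
  by_cases h1 : ∀ a : Fin M, par M N (K (Fin.castAdd N a)) = 0 <;> simp [IsMixed, h1]

theorem par_castAdd (a : Fin M) : par M N (Fin.castAdd N a) = 0 := by simp [par]

theorem par_natAdd (b : Fin N) : par M N (Fin.natAdd M b) = 1 := by simp [par]

variable {M N}

/-- The index with values `K₁` in the even and `K₂` in the odd places. -/
def mix (K₁ : Fin M → Fin M) (K₂ : Fin N → Fin N) : Fin (M + N) → Fin (M + N) :=
  Fin.append (Fin.castAdd N ∘ K₁) (Fin.natAdd M ∘ K₂)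

theorem mix_castAdd (K₁ : Fin M → Fin M) (K₂ : Fin N → Fin N) (a : Fin M) :
    mix K₁ K₂ (Fin.castAdd N a) = Fin.castAdd N (K₁ a) := Fin.append_left _ _ _

theorem mix_natAdd (K₁ : Fin M → Fin M) (K₂ : Fin N → Fin N) (b : Fin N) :
    mix K₁ K₂ (Fin.natAdd M b) = Fin.natAdd M (K₂ b) := Fin.append_right _ _ _

theorem isMixed_mix (K₁ : Fin M → Fin M) (K₂ : Fin N → Fin N) : IsMixed M N (mix K₁ K₂) :=
  ⟨fun a => by rw [mix_castAdd, par_castAdd], fun b => by rw [mix_natAdd, par_natAdd]⟩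

theorem mix_inj {K₁ L₁ : Fin M → Fin M} {K₂ L₂ : Fin N → Fin N} :
    mix K₁ K₂ = mix L₁ L₂ ↔ K₁ = L₁ ∧ K₂ = L₂ := by
  constructor
  · intro h
    constructor
    · funext a
      have := congrFun h (Fin.castAdd N a)
      rw [mix_castAdd, mix_castAdd] at this
      exact Fin.castAdd_injective M N this
    · funext b
      have := congrFun h (Fin.natAdd M b)
      rw [mix_natAdd, mix_natAdd] at this
      exact Fin.natAdd_injective N M this
  · rintro ⟨rfl, rfl⟩
    rfl

theorem IsMixed.exists_eq_mix {K : Fin (M + N) → Fin (M + N)} (h : IsMixed M N K) :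
    ∃ K₁ K₂, K = mix K₁ K₂ := by
  have h1 : ∀ a : Fin M, (K (Fin.castAdd N a)).val < M := fun a => by
    by_contra hn
    have := h.1 a
    rw [par, if_neg hn] at this
    exact one_ne_zero this
  have h2 : ∀ b : Fin N, M ≤ (K (Fin.natAdd M b)).val := fun b => by
    by_contra hn
    have := h.2 b
    rw [par, if_pos (not_le.mp hn)] at this
    exact zero_ne_one this
  refine ⟨fun a => ⟨K (Fin.castAdd N a), h1 a⟩,
    fun b => ⟨K (Fin.natAdd M b) - M, by have := h2 b; omega⟩, ?_⟩
  funext c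
  refine Fin.addCases (fun a => ?_) (fun b => ?_) c
  · rw [mix_castAdd]; rfl
  · rw [mix_natAdd]
    ext
    rw [Fin.val_natAdd, Nat.add_sub_cancel' (h2 b)]

theorem fusionOp_mix_mix (L₁ K₁ : Fin M → Fin M) (L₂ K₂ : Fin N → Fin N) :
    fusionOp M N (mix L₁ L₂) (mix K₁ K₂) =
      (mapSign L₁ * mapSign K₁) * (mapSign L₂ * mapSign K₂) := by
  rw [fusionOp, tensorOp, Matrix.of_apply]
  simp only [mix_castAdd, mix_natAdd]
  -- The last $N$ places have the same total parity in the row and in the column, so the sign in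
  -- $G\otimes H$ is trivial.
  have ht : ∀ J : Fin N → Fin N, tpar (par M N) N (fun b => Fin.natAdd M (J b)) = N := fun J => by
    simp [tpar, par_natAdd]
  rw [ht, ht, SuperMat.zmod_add_self, zero_mul, ksign_zero, one_smul,
    antisymmetrizer_apply fun a => par_castAdd M N _, symmetrizer_apply fun a => par_natAdd M N _,
    ← sum_sign_comp_eq, ← sum_sign_comp_eq]
  congr 1
  · refine Finset.sum_congr rfl fun σ _ => if_congr ?_ rfl rfl
    simp only [funext_iff, Function.comp_apply, Fin.castAdd_inj]
  · refine Finset.sum_congr rfl fun σ _ => if_congr ?_ rfl rfl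
    simp only [funext_iff, Function.comp_apply, Fin.natAdd_inj]

/-- $A^{(M|N)}$ only permutes indices within the first $M$ and within the last $N$ places, so it
preserves the image of $\Im$. Hence it commutes with $\Im$. -/
theorem isMixed_iff_of_fusionOp_ne_zero {L K : Fin (M + N) → Fin (M + N)}
    (h : fusionOp M N L K ≠ 0) : IsMixed M N L ↔ IsMixed M N K := by
  rw [fusionOp, tensorOp, Matrix.of_apply] at h
  have h' := right_ne_zero_of_smul h
  obtain ⟨σ, hσ⟩ := exists_comp_eq_of_antisymmetrizer_ne_zero (left_ne_zero_of_mul h')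
  obtain ⟨τ, hτ⟩ := exists_comp_eq_of_symmetrizer_ne_zero (right_ne_zero_of_mul h')
  have h1 : ∀ a, K (Fin.castAdd N a) = L (Fin.castAdd N (σ a)) := fun a => (congrFun hσ a).symm
  have h2 : ∀ b, K (Fin.natAdd M b) = L (Fin.natAdd M (τ b)) := fun b => (congrFun hτ b).symm
  unfold IsMixed
  simp only [h1, h2]
  exact and_congr (σ.forall_congr_right (q := fun a => par M N (L (Fin.castAdd N a)) = 0)).symm
    (τ.forall_congr_right (q := fun b => par M N (L (Fin.natAdd M b)) = 1)).symm

variable (M N)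

/-- The coordinates of the vector that spans the image of `ℑ A^{(M|N)}`. -/
noncomputable def fusionVec (K : Fin (M + N) → Fin (M + N)) : ℂ :=
  ∑ σ : Equiv.Perm (Fin M), ∑ τ : Equiv.Perm (Fin N),
    if mix σ τ = K then ((Equiv.Perm.sign σ : ℤ) : ℂ) * ((Equiv.Perm.sign τ : ℤ) : ℂ) else 0

variable {M N}

theorem fusionVec_mix (K₁ : Fin M → Fin M) (K₂ : Fin N → Fin N) :
    fusionVec M N (mix K₁ K₂) = mapSign K₁ * mapSign K₂ := by
  unfold fusionVec mapSign
  rw [Int.cast_sum, Int.cast_sum, Finset.sum_mul_sum]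
  refine Finset.sum_congr rfl fun σ _ => Finset.sum_congr rfl fun τ _ => ?_
  simp only [mix_inj]
  by_cases h1 : K₁ = σ
  · by_cases h2 : K₂ = τ
    · simp [h1, h2]
    · simp [h2, Ne.symm h2]
  · simp [h1, Ne.symm h1]

theorem fusionVec_eq_zero {K : Fin (M + N) → Fin (M + N)} (h : ¬ IsMixed M N K) :
    fusionVec M N K = 0 := by
  refine Finset.sum_eq_zero fun σ _ => Finset.sum_eq_zero fun τ _ => if_neg ?_
  rintro rfl
  exact h (isMixed_mix _ _)

theorem sum_fusionVec_smul {B : Type*} [AddCommGroup B] [Module ℂ B]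
    (f : (Fin (M + N) → Fin (M + N)) → B) :
    ∑ J, fusionVec M N J • f J = ∑ σ : Equiv.Perm (Fin M), ∑ τ : Equiv.Perm (Fin N),
      (((Equiv.Perm.sign σ : ℤ) : ℂ) * ((Equiv.Perm.sign τ : ℤ) : ℂ)) • f (mix σ τ) := by
  unfold fusionVec
  simp only [Finset.sum_smul]
  rw [Finset.sum_comm]
  refine Finset.sum_congr rfl fun σ _ => ?_
  rw [Finset.sum_comm]
  refine Finset.sum_congr rfl fun τ _ => ?_
  simp only [ite_smul, zero_smul, Finset.sum_ite_eq, Finset.mem_univ, if_true]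

variable (M N)

theorem sum_fusionVec_sq :
    ∑ J, fusionVec M N J * fusionVec M N J = (M.factorial : ℂ) * (N.factorial : ℂ) := by
  have h : ∀ {n : ℕ} (σ : Equiv.Perm (Fin n)),
      ((Equiv.Perm.sign σ : ℤ) : ℂ) * ((Equiv.Perm.sign σ : ℤ) : ℂ) = 1 := fun σ => by
    rw [← Int.cast_mul, ← Units.val_mul, Int.units_mul_self]; simp
  have := sum_fusionVec_smul (fusionVec M N)
  simp only [smul_eq_mul] at this
  rw [this]
  simp only [fusionVec_mix, mapSign_coe, mul_mul_mul_comm, h, Finset.sum_const, Finset.card_univ,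
    Fintype.card_perm, Fintype.card_fin, nsmul_eq_mul, mul_one]

/-- On mixed indices the matrix entries factor into row and column signs by `sum_sign_comp_eq`.
Elsewhere both sides vanish. -/
theorem projMixed_mul_fusionOp :
    projMixed M N * fusionOp M N = Matrix.vecMulVec (fusionVec M N) (fusionVec M N) := by
  ext L K
  rw [projMixed_eq, Matrix.diagonal_mul, Matrix.vecMulVec_apply]
  by_cases hL : IsMixed M N L
  · rw [if_pos hL, one_mul]
    by_cases hK : IsMixed M N K
    · obtain ⟨L₁, L₂, rfl⟩ := hL.exists_eq_mix
      obtain ⟨K₁, K₂, rfl⟩ := hK.exists_eq_mix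
      rw [fusionOp_mix_mix, fusionVec_mix, fusionVec_mix]
      ring
    · rw [fusionVec_eq_zero hK, mul_zero]
      by_contra h
      exact hK ((isMixed_iff_of_fusionOp_ne_zero h).mp hL)
  · rw [if_neg hL, fusionVec_eq_zero hL, zero_mul, zero_mul]

theorem fusionOp_mul_projMixed : fusionOp M N * projMixed M N = projMixed M N * fusionOp M N := by
  ext L K
  rw [projMixed_eq, Matrix.diagonal_mul, Matrix.mul_diagonal, mul_comm]
  by_cases h : fusionOp M N L K = 0
  · rw [h, mul_zero, mul_zero]
  · simp only [isMixed_iff_of_fusionOp_ne_zero h]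

theorem fusionProj_eq : fusionProj M N =
    ((M.factorial : ℂ) * (N.factorial : ℂ))⁻¹ •
      Matrix.vecMulVec (fusionVec M N) (fusionVec M N) := by
  rw [fusionProj, projMixed_mul_fusionOp]

theorem factorial_mul_factorial_ne_zero : (M.factorial : ℂ) * (N.factorial : ℂ) ≠ 0 :=
  mul_ne_zero (Nat.cast_ne_zero.mpr M.factorial_ne_zero) (Nat.cast_ne_zero.mpr N.factorial_ne_zero)

theorem fusionProj_mul_self : fusionProj M N * fusionProj M N = fusionProj M N := by
  have h : fusionVec M N ⬝ᵥ fusionVec M N = (M.factorial : ℂ) * (N.factorial : ℂ) :=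
    sum_fusionVec_sq M N
  rw [fusionProj_eq, Matrix.smul_mul, Matrix.mul_smul, Matrix.vecMulVec_mul_vecMulVec, h,
    Matrix.vecMulVec_smul, smul_smul, smul_smul, mul_assoc,
    inv_mul_cancel₀ (factorial_mul_factorial_ne_zero M N), mul_one]

/-- Supplies the nonzero entry that proves the rank positive and the entry at which a solution of
the fusion identity is read off. -/
theorem fusionVec_mix_id : fusionVec M N (mix id id) = 1 := by
  have h : ∀ n : ℕ, mapSign (id : Fin n → Fin n) = 1 := fun n => by
    rw [← Equiv.Perm.coe_one, mapSign_coe]; simp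
  rw [fusionVec_mix, h, h]
  simp

theorem rank_fusionOp_mul_projMixed : (fusionOp M N * projMixed M N).rank = 1 := by
  rw [fusionOp_mul_projMixed, projMixed_mul_fusionOp]
  refine le_antisymm (Matrix.rank_vecMulVec_le _ _) (Nat.one_le_iff_ne_zero.mpr fun h => ?_)
  have h0 : Matrix.vecMulVec (fusionVec M N) (fusionVec M N) = 0 := by
    rw [Matrix.rank, Submodule.finrank_eq_zero, LinearMap.range_eq_bot] at h
    ext L K
    have := congrFun (LinearMap.congr_fun h (Pi.single K 1)) L
    simpa using this
  have := congrFun (congrFun h0 (mix id id)) (mix id id)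
  rw [Matrix.vecMulVec_apply, fusionVec_mix_id] at this
  simp at this

end Mixed

/-! ## The fusion identity -/

section Fusion

variable {M N : ℕ}

theorem eq_zero_of_add_self_eq_zero {B : Type*} [AddCommGroup B] [Module ℂ B] (x : B)
    (h : x + x = 0) : x = 0 := by
  rw [← two_smul ℂ x] at h
  exact (smul_eq_zero.mp h).resolve_left two_ne_zero

variable (M N)

/-- The factors `t_{ij}(w_a)` of the even part of the Berezinian. -/
noncomputable def evenFactor (a i j : Fin M) : (Yangian M N)⟦X⟧ :=
  shift ((M : ℂ) - N - ((a : ℕ) + 1)) (T M N (Fin.castAdd N i) (Fin.castAdd N j))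

/-- The factors `t̃_{ji}(w_{M+b})` of the odd part of the Berezinian. -/
noncomputable def oddFactor (b i j : Fin N) : (Yangian M N)⟦X⟧ :=
  shift (-(N : ℂ) + (b : ℕ)) (Tinv M N (Fin.natAdd M j) (Fin.natAdd M i))

theorem berezinian_eq :
    berezinian M N = altSum (evenFactor M N) id id * altSum (oddFactor M N) id id := rfl

theorem evenFactor_rel (a b : Fin M) (hab : a.val + 1 = b.val) (i k j l : Fin M) :
    evenFactor M N a i j * evenFactor M N b k l - evenFactor M N a k j * evenFactor M N b i l +
      (evenFactor M N a i l * evenFactor M N b k j -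
        evenFactor M N a k l * evenFactor M N b i j) = 0 := by
  have hc : ((M : ℂ) - N - ((a : ℕ) + 1)) - ((M : ℂ) - N - ((b : ℕ) + 1)) = 1 := by
    rw [← hab]; push_cast; ring
  have h1 := T_entries_even (par_castAdd M N i) (par_castAdd M N j) (par_castAdd M N k)
    (par_castAdd M N l) hc
  have h2 := T_entries_even (par_castAdd M N i) (par_castAdd M N l) (par_castAdd M N k)
    (par_castAdd M N j) hc
  rw [sub_eq_iff_eq_add] at h1 h2
  simp only [evenFactor]
  rw [h1, h2]
  -- Besides the four wanted products, each relation yields two products in the opposite order.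
  -- These cancel between the relation and its copy with the column indices $j$ and $l$ exchanged.
  abel

theorem oddFactor_rel (a b : Fin N) (hab : a.val + 1 = b.val) (i k j l : Fin N) :
    oddFactor M N a i j * oddFactor M N b k l - oddFactor M N a k j * oddFactor M N b i l +
      (oddFactor M N a i l * oddFactor M N b k j -
        oddFactor M N a k l * oddFactor M N b i j) = 0 := by
  have hc : (-(N : ℂ) + (a : ℕ)) - (-(N : ℂ) + (b : ℕ)) = -1 := by
    rw [← hab]; push_cast; ring
  have h1 := Tinv_entries_odd (par_natAdd M N j) (par_natAdd M N i) (par_natAdd M N l)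
    (par_natAdd M N k) hc
  have h2 := Tinv_entries_odd (par_natAdd M N l) (par_natAdd M N i) (par_natAdd M N j)
    (par_natAdd M N k) hc
  rw [sub_eq_iff_eq_add] at h1 h2
  simp only [oddFactor]
  rw [h1, h2]
  abel

/-- For odd indices the sign exponent $|i||j|+|j|$ is even. The transposition makes the row index of
$T^*$ the column index of $T^{-1}$, as in the odd factor of the Berezinian. -/
theorem Tstar_odd (i j : Fin N) :
    Tstar M N (Fin.natAdd M i) (Fin.natAdd M j) = Tinv M N (Fin.natAdd M j) (Fin.natAdd M i) := by
  have h : ksign (1 * 1 + 1) = 1 := by decide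
  rw [Tstar, SuperMat.transpose, par_natAdd, par_natAdd, h, one_smul]

theorem fusedT_mix (J₁ K₁ : Fin M → Fin M) (J₂ K₂ : Fin N → Fin N) :
    fusedT M N (mix J₁ J₂) (mix K₁ K₂) =
      (List.ofFn fun a => evenFactor M N a (J₁ a) (K₁ a)).prod *
        (List.ofFn fun b => oddFactor M N b (J₂ b) (K₂ b)).prod := by
  have h := SuperMat.prod_placed_apply (p := par M N)
    (fun a : Fin (M + N) => (fun i j =>
      shift (wShift M N a) (if a.val < M then T M N i j else Tstar M N i j) :
        SuperMat (par M N) (Yangian M N)⟦X⟧))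
    (List.finRange (M + N)) (List.nodup_finRange _) (mix J₁ J₂) (mix K₁ K₂)
    (fun c => by
      refine Fin.addCases (fun a => ?_) (fun b => ?_) c
      · rw [mix_castAdd, mix_castAdd, par_castAdd, par_castAdd]
      · rw [mix_natAdd, mix_natAdd, par_natAdd, par_natAdd])
    (fun b hb => absurd (List.mem_finRange b) hb)
  rw [← List.ofFn_eq_map, ← List.ofFn_eq_map] at h
  refine h.trans ?_
  rw [← List.prod_append, ← List.ofFn_fin_append]
  congr 2
  funext c
  refine Fin.addCases (fun a => ?_) (fun b => ?_) c
  · rw [Fin.append_left, mix_castAdd, mix_castAdd, if_pos (by simp), wShift, if_pos (by simp)]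
    rfl
  · rw [Fin.append_right, mix_natAdd, mix_natAdd, if_neg (by simp), wShift, if_neg (by simp),
      Tstar_odd, oddFactor]
    congr 1
    -- The place is $M+b$ counted from zero, so the shift is $-M-N-1+(M+b+1)=-N+b$.
    rw [Fin.val_natAdd]
    push_cast
    ring

theorem sum_sum_smul_mul {m n : ℕ} {A : Type*} [Ring A] [Algebra ℂ A]
    (F : Fin m → Fin m → Fin m → A) (G : Fin n → Fin n → Fin n → A)
    (K₁ : Fin m → Fin m) (K₂ : Fin n → Fin n) :
    ∑ σ : Equiv.Perm (Fin m), ∑ τ : Equiv.Perm (Fin n),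
      (((Equiv.Perm.sign σ : ℤ) : ℂ) * ((Equiv.Perm.sign τ : ℤ) : ℂ)) •
        ((List.ofFn fun a => F a (σ a) (K₁ a)).prod * (List.ofFn fun b => G b (τ b) (K₂ b)).prod) =
      altSum F id K₁ * altSum G id K₂ := by
  unfold altSum
  rw [Finset.sum_mul_sum]
  refine Finset.sum_congr rfl fun σ _ => Finset.sum_congr rfl fun τ _ => ?_
  rw [← Int.cast_smul_eq_zsmul ℂ, ← Int.cast_smul_eq_zsmul ℂ, smul_mul_smul_comm]
  rfl

theorem zsmul_mul_zsmul_eq {A : Type*} [Ring A] [Algebra ℂ A] (y z : ℤ) (a b : A) :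
    (y • a) * (z • b) = ((y : ℂ) * z) • (a * b) := by
  rw [← Int.cast_smul_eq_zsmul ℂ, ← Int.cast_smul_eq_zsmul ℂ, smul_mul_smul_comm]

/-- The row vector $v^{\mathsf T}$ antisymmetrizes the rows of $\mathbb T(u)$. The exchange
relations then force antisymmetry in the columns, so only the multiple of $v_K$ by the value at the
identity columns remains. -/
theorem sum_fusionVec_smul_fusedT {K : Fin (M + N) → Fin (M + N)} (hK : IsMixed M N K) :
    ∑ J, fusionVec M N J • fusedT M N J K = fusionVec M N K • berezinian M N := by
  obtain ⟨K₁, K₂, rfl⟩ := hK.exists_eq_mix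
  rw [sum_fusionVec_smul]
  simp only [fusedT_mix]
  rw [sum_sum_smul_mul, altSum_id_eq eq_zero_of_add_self_eq_zero _ (evenFactor_rel M N),
    altSum_id_eq eq_zero_of_add_self_eq_zero _ (oddFactor_rel M N), zsmul_mul_zsmul_eq,
    fusionVec_mix, berezinian_eq]

/-! ### The constant term of the Berezinian -/

theorem constantCoeff_T (i j : Fin (M + N)) :
    PowerSeries.constantCoeff (T M N i j) = if i = j then 1 else 0 := by
  rw [← PowerSeries.coeff_zero_eq_constantCoeff_apply, T, PowerSeries.coeff_mk, coeffT_zero,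
    SuperMat.one_apply]

theorem SuperMat.coeffMat_zero_mul {ι A : Type*} [Fintype ι] [DecidableEq ι] {p : ι → ZMod 2}
    [Ring A] [Algebra ℂ A] [Superalgebra A] (F G : SuperMat p A⟦X⟧) :
    (F * G).coeffMat 0 = F.coeffMat 0 * G.coeffMat 0 := by
  refine SuperMat.ext fun i k => ?_
  rw [SuperMat.coeffMat, SuperMat.mul_apply, SuperMat.mul_apply, map_sum]
  refine Finset.sum_congr rfl fun j _ => ?_
  rw [PowerSeries.coeff_zero_eq_constantCoeff_apply, map_mul,
    ← PowerSeries.coeff_zero_eq_constantCoeff_apply,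
    ← PowerSeries.coeff_zero_eq_constantCoeff_apply, SuperMat.coeff_parityPow]
  rfl

theorem coeffMat_zero_Tinv : (Tinv M N).coeffMat 0 = 1 := by
  have h := congrArg (SuperMat.coeffMat 0) (Ring.mul_inverse_cancel _ (isUnit_T M N))
  rw [SuperMat.coeffMat_zero_mul, coeffMat_T, coeffT_zero, one_mul] at h
  refine h.trans (SuperMat.ext fun i j => ?_)
  rw [SuperMat.coeffMat, SuperMat.one_apply, SuperMat.one_apply]
  split_ifs <;> simp

theorem constantCoeff_Tinv (i j : Fin (M + N)) :
    PowerSeries.constantCoeff (Tinv M N i j) = if i = j then 1 else 0 := by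
  rw [← PowerSeries.coeff_zero_eq_constantCoeff_apply, ← SuperMat.one_apply (p := par M N),
    ← coeffMat_zero_Tinv]
  rfl

/-- At $u=\infty$ both $T$ and $T^{-1}$ become the identity and shifts have no effect, so each
alternating sum is the determinant of the identity matrix. -/
theorem constantCoeff_berezinian : PowerSeries.constantCoeff (berezinian M N) = 1 := by
  have h1 : (fun a i j => PowerSeries.constantCoeff (evenFactor M N a i j)) =
      fun _ i j => if i = j then 1 else 0 := by
    funext a i j
    rw [evenFactor, coeff_zero_shift, constantCoeff_T]
    simp only [Fin.castAdd_inj]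
  have h2 : (fun b i j => PowerSeries.constantCoeff (oddFactor M N b i j)) =
      fun _ i j => if i = j then 1 else 0 := by
    funext b i j
    rw [oddFactor, coeff_zero_shift, constantCoeff_Tinv]
    simp only [Fin.natAdd_inj, eq_comm]
  rw [berezinian_eq, map_mul, map_altSum, map_altSum, h1, h2, altSum_delta_id, altSum_delta_id,
    mul_one]

/-! ### Entries of both sides of the fusion identity, and uniqueness -/

theorem SuperMat.ofOp_vecMulVec_mul_apply {ι A : Type*} [Fintype ι] [DecidableEq ι]
    {p : ι → ZMod 2} [Ring A] [Algebra ℂ A] [Superalgebra A] (v w : ι → ℂ) (Y : SuperMat p A)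
    (i k : ι) :
    (SuperMat.ofOp (Matrix.vecMulVec v w) * Y : SuperMat p A) i k =
      v i • ∑ j, w j • Y j k := by
  rw [SuperMat.ofOp_mul_apply, Finset.smul_sum]
  simp only [Matrix.vecMulVec_apply, mul_smul]

theorem SuperMat.mul_ofOp_diagonal_apply {ι A : Type*} [Fintype ι] [DecidableEq ι]
    {p : ι → ZMod 2} [Ring A] [Algebra ℂ A] [Superalgebra A] (d : ι → ℂ) (Y : SuperMat p A)
    (i k : ι) :
    (Y * SuperMat.ofOp (Matrix.diagonal d) : SuperMat p A) i k = d k • Y i k := by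
  rw [SuperMat.mul_ofOp_apply, Finset.sum_eq_single k]
  · rw [Matrix.diagonal_apply_eq]
  · intro j _ h
    rw [Matrix.diagonal_apply_ne _ h, zero_smul]
  · simp
  · intro i j h
    by_contra hne
    exact h (Matrix.diagonal_apply_ne _ fun e => hne (e ▸ rfl))

theorem fusion_left_apply (D : (Yangian M N)⟦X⟧) (L K : Fin (M + N) → Fin (M + N)) :
    ((SuperMat.ofOp (projMixed M N * fusionOp M N) : FusionAlg M N) * SuperMat.ofCoeff D *
      SuperMat.ofOp (projMixed M N) : FusionAlg M N) L K = (fusionVec M N L * fusionVec M N K) • D := by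
  rw [projMixed_mul_fusionOp, projMixed_eq, SuperMat.mul_ofOp_diagonal_apply,
    SuperMat.ofOp_vecMulVec_mul_apply, Finset.sum_eq_single K]
  · by_cases hK : IsMixed M N K
    · rw [if_pos hK, one_smul, mul_smul, SuperMat.ofCoeff, if_pos rfl]
    · rw [if_neg hK, zero_smul, fusionVec_eq_zero hK, mul_zero, zero_smul]
  · intro J _ hJ
    rw [SuperMat.ofCoeff, if_neg hJ, smul_zero]
  · simp

theorem fusion_right_apply (L K : Fin (M + N) → Fin (M + N)) :
    ((SuperMat.ofOp (projMixed M N * fusionOp M N) : FusionAlg M N) * fusedT M N *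
      SuperMat.ofOp (projMixed M N) : FusionAlg M N) L K =
        (fusionVec M N L * fusionVec M N K) • berezinian M N := by
  rw [projMixed_mul_fusionOp, projMixed_eq, SuperMat.mul_ofOp_diagonal_apply,
    SuperMat.ofOp_vecMulVec_mul_apply]
  by_cases hK : IsMixed M N K
  · rw [if_pos hK, one_smul, sum_fusionVec_smul_fusedT M N hK, mul_smul]
  · rw [if_neg hK, zero_smul, fusionVec_eq_zero hK, mul_zero, zero_smul]

theorem fusion_identity :
    (SuperMat.ofOp (projMixed M N * fusionOp M N) : FusionAlg M N) *
        SuperMat.ofCoeff (berezinian M N) * SuperMat.ofOp (projMixed M N) =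
      SuperMat.ofOp (projMixed M N * fusionOp M N) * fusedT M N *
        SuperMat.ofOp (projMixed M N) :=
  SuperMat.ext fun L K => by rw [fusion_left_apply, fusion_right_apply]

theorem eq_berezinian_of_fusion_identity (D : (Yangian M N)⟦X⟧)
    (h : (SuperMat.ofOp (projMixed M N * fusionOp M N) : FusionAlg M N) *
        SuperMat.ofCoeff D * SuperMat.ofOp (projMixed M N) =
      SuperMat.ofOp (projMixed M N * fusionOp M N) * fusedT M N *
        SuperMat.ofOp (projMixed M N)) : D = berezinian M N := by
  have := congrFun (congrFun h (mix id id)) (mix id id)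
  rwa [fusion_left_apply, fusion_right_apply, fusionVec_mix_id, mul_one, one_smul,
    one_smul] at this

/-! ### The supertrace formulas -/

/-- On the diagonal the factor $v_K$ on the left already kills non-mixed $K$, so a further $\Im$ on
the right does not change the supertrace. -/
theorem fusionProj_mul_fusedT_diag (K : Fin (M + N) → Fin (M + N)) :
    ((SuperMat.ofOp (fusionProj M N) : FusionAlg M N) * fusedT M N) K K =
      (((M.factorial : ℂ) * (N.factorial : ℂ))⁻¹ * (fusionVec M N K * fusionVec M N K)) •
        berezinian M N := by
  rw [fusionProj_eq, ← Matrix.smul_vecMulVec, SuperMat.ofOp_vecMulVec_mul_apply]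
  by_cases hK : IsMixed M N K
  · rw [sum_fusionVec_smul_fusedT M N hK, smul_smul, Pi.smul_apply, smul_eq_mul, mul_assoc]
  · rw [Pi.smul_apply, fusionVec_eq_zero hK, smul_zero, zero_smul, mul_zero, mul_zero, zero_smul]

theorem ksign_natCast (n : ℕ) : ksign (n : ZMod 2) = (-1) ^ n := by
  induction n with
  | zero => simp [ksign_zero]
  | succ n ih =>
    have h1 : ksign 1 = -1 := by decide
    rw [Nat.cast_succ, ksign_add, ih, h1, pow_succ]

theorem IsMixed.ksign_tpar {M N : ℕ} {K : Fin (M + N) → Fin (M + N)} (h : IsMixed M N K) :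
    ksign (tpar (par M N) (M + N) K) = (-1) ^ N := by
  rw [← ksign_natCast, tpar, Fin.sum_univ_add]
  simp [h.1, h.2]

/-- Every $K$ with $v_K\ne0$ has $N$ odd places, so its supertrace sign is $(-1)^N$. The weights
$v_K^2/(M!\,N!)$ add up to $1$. -/
theorem eq_str_of_diag {A : Type*} [Ring A] [Algebra ℂ A] [Superalgebra A] {b : A}
    {X : SuperMat (tpar (par M N) (M + N)) A}
    (hX : ∀ K, X K K = (((M.factorial : ℂ) * (N.factorial : ℂ))⁻¹ *
      (fusionVec M N K * fusionVec M N K)) • b) : b = (-1) ^ N * X.str := by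
  have h : ∀ K, ksign (tpar (par M N) (M + N) K) • X K K = ((-1) ^ N : ℤ) •
      (((M.factorial : ℂ) * (N.factorial : ℂ))⁻¹ * (fusionVec M N K * fusionVec M N K)) • b := by
    intro K
    rw [hX]
    by_cases hK : IsMixed M N K
    · rw [hK.ksign_tpar]
    · rw [fusionVec_eq_zero hK, mul_zero, mul_zero, zero_smul, smul_zero, smul_zero]
  rw [SuperMat.str, Finset.sum_congr rfl fun K _ => h K, ← Finset.smul_sum, ← Finset.sum_smul,
    ← Finset.mul_sum, sum_fusionVec_sq, inv_mul_cancel₀ (factorial_mul_factorial_ne_zero M N),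
    one_smul, zsmul_eq_mul, ← mul_assoc]
  push_cast
  rw [← pow_add, Even.neg_one_pow ⟨N, rfl⟩, one_mul]

theorem berezinian_eq_str :
    berezinian M N = (-1) ^ N *
      ((SuperMat.ofOp (fusionProj M N) : FusionAlg M N) * fusedT M N).str :=
  eq_str_of_diag M N (fusionProj_mul_fusedT_diag M N)

theorem berezinian_eq_str_projMixed :
    berezinian M N = (-1) ^ N *
      ((SuperMat.ofOp (fusionProj M N) : FusionAlg M N) * fusedT M N *
        SuperMat.ofOp (projMixed M N)).str := by
  refine eq_str_of_diag M N fun K => ?_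
  rw [projMixed_eq, SuperMat.mul_ofOp_diagonal_apply, fusionProj_mul_fusedT_diag]
  by_cases hK : IsMixed M N K
  · rw [if_pos hK, one_smul]
  · rw [if_neg hK, fusionVec_eq_zero hK, zero_smul, mul_zero, mul_zero, zero_smul]

end Fusion

end SuperYangian

theorem mainTheorem12 (M N : ℕ) :
    -- the normalized operator is a projection with one-dimensional image
    (SuperYangian.fusionProj M N * SuperYangian.fusionProj M N = SuperYangian.fusionProj M N ∧
      (SuperYangian.fusionOp M N * SuperYangian.projMixed M N).rank = 1) ∧
    -- the Berezinian belongs to `1 + u⁻¹ Y⟦u⁻¹⟧`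
    PowerSeries.constantCoeff (SuperYangian.berezinian M N) = 1 ∧
    -- the fusion identity
    ((SuperYangian.SuperMat.ofOp (SuperYangian.projMixed M N * SuperYangian.fusionOp M N) :
          SuperYangian.FusionAlg M N) *
        SuperYangian.SuperMat.ofCoeff (SuperYangian.berezinian M N) *
        SuperYangian.SuperMat.ofOp (SuperYangian.projMixed M N) =
      SuperYangian.SuperMat.ofOp (SuperYangian.projMixed M N * SuperYangian.fusionOp M N) *
        SuperYangian.fusedT M N * SuperYangian.SuperMat.ofOp (SuperYangian.projMixed M N)) ∧
    -- the Berezinian is the only series that satisfies the fusion identity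
    (∀ D : PowerSeries (SuperYangian.Yangian M N),
      (SuperYangian.SuperMat.ofOp (SuperYangian.projMixed M N * SuperYangian.fusionOp M N) :
          SuperYangian.FusionAlg M N) *
        SuperYangian.SuperMat.ofCoeff D *
        SuperYangian.SuperMat.ofOp (SuperYangian.projMixed M N) =
      SuperYangian.SuperMat.ofOp (SuperYangian.projMixed M N * SuperYangian.fusionOp M N) *
        SuperYangian.fusedT M N * SuperYangian.SuperMat.ofOp (SuperYangian.projMixed M N) →
      D = SuperYangian.berezinian M N) ∧
    -- the supertrace formulas
    (SuperYangian.berezinian M N = (-1) ^ N *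
      ((SuperYangian.SuperMat.ofOp (SuperYangian.fusionProj M N) : SuperYangian.FusionAlg M N) *
        SuperYangian.fusedT M N).str) ∧
    (SuperYangian.berezinian M N = (-1) ^ N *
      ((SuperYangian.SuperMat.ofOp (SuperYangian.fusionProj M N) : SuperYangian.FusionAlg M N) *
        SuperYangian.fusedT M N *
        SuperYangian.SuperMat.ofOp (SuperYangian.projMixed M N)).str) :=
  ⟨⟨SuperYangian.fusionProj_mul_self M N, SuperYangian.rank_fusionOp_mul_projMixed M N⟩,
    SuperYangian.constantCoeff_berezinian M N, SuperYangian.fusion_identity M N,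
    SuperYangian.eq_berezinian_of_fusion_identity M N, SuperYangian.berezinian_eq_str M N,
    SuperYangian.berezinian_eq_str_projMixed M N⟩
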